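/- Let $H\in(1/2,1)$, $x_0\in\mathbb{R}$, let $a\in C^2(\mathbb{R})$ and $\sigma\in C^3(\mathbb{R})$ be bounded with bounded derivatives (up to order $2$ and $3$, respectively), and let $\inf_{x\in\mathbb{R}}\sigma(x)>0$. Let $B=(B_t)_{t\in[0,1]}$ be a fractional Brownian motion with Hurst parameter $H$, i.e. a continuous centered Gaussian process with $\mathbf{E}B_sB_t=\frac12(s^{2H}+t^{2H}-|t-s|^{2H})$. Let $X$ be the solution of $$X_t=x_0+\int_0^t a(X_\tau)\,d\tau+\int_0^t\sigma(X_\tau)\,dB_\tau,\qquad t\in[0,1],$$ where integrals with respect to $B$ are pathwise Riemann–Stieltjes integrals. For $n\ge1$ let $\widetilde B^{(n)}$ be the piecewise linear interpolation of $B$ with stepsize $1/n$, $$\widetilde B^{(n)}_t=B_{k/n}+(nt-k)\,(B_{(k+1)/n}-B_{k/n}),\qquad t\in[k/n,(k+1)/n],\ k=0,\dots,n-1,$$ and let $\widetilde X^{(n)}$ be the solution of $$\widetilde X^{(n)}_t=x_0+\int_0^t a(\widetilde X^{(n)}_\tau)\,d\tau+\int_0^t\sigma(\widetilde X^{(n)}_\tau)\,d\widetilde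 B^{(n)}_\tau,\qquad t\in[0,1].$$ Put $$\mathcal{Y}_t=(a\sigma'-a'\sigma)(X_t)\exp\Big(\int_t^1a'(X_s)\,ds+\int_t^1\sigma'(X_s)\,dB_s\Big),\qquad t\in[0,1].$$ Then, almost surely, the Riemann–Stieltjes integrals $\int_t^1\sigma'(X_s)\,dB_s$ exist for all $t\in[0,1]$; for every $n\ge1$ the integral $\int_0^1\mathcal{Y}_t(B_t-\widetilde B^{(n)}_t)\,dt$ exists almost surely, and it and $X_1-\widetilde X^{(n)}_1$ are square integrable. Moreover there is a constant $C$, depending only on $H,x_0,a,\sigma$, such that for all $n\ge1$ $$\Big|\,\mathbf{E}|X_1-\widetilde X^{(n)}_1|^2-\mathbf{E}\Big|\int_0^1\mathcal{Y}_t(B_t-\widetilde B^{(n)}_t)\,dt\Big|^2\,\Big|\le C\,n^{-2H}$$ and $$\Big|\,\big(\mathbf{E}|X_1-\widetilde X^{(n)}_1|^2\big)^{1/2}-\Big(\mathbf{E}\Big|\int_0^1\mathcal{Y}_t(B_t-\widetilde B^{(n)}_t)\,dt\Big|^2\Big)^{1/2}\,\Big|\le C\,n^{-2H}.$$ -/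

import Mathlib

open MeasureTheory ProbabilityTheory Set

noncomputable section

/-- `B` (restricted to the time interval `[0,1]`) is a fractional Brownian motion with Hurst
parameter `H` under `P`: a centered Gaussian process with almost surely continuous paths and
covariance `R_H(s,t) = (s^{2H} + t^{2H} - |t-s|^{2H}) / 2`. The values of `B` outside `[0,1]`
play no role. -/
structure IsFractionalBrownianMotion {Ω : Type*} [MeasurableSpace Ω] (H : ℝ)
    (B : ℝ → Ω → ℝ) (P : Measure Ω) : Prop where
  isGaussianProcess : IsGaussianProcess (fun t : Icc (0 : ℝ) 1 => B t) P
  centered : ∀ t ∈ Icc (0 : ℝ) 1, ∫ ω, B t ω ∂P = 0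
  covariance : ∀ s ∈ Icc (0 : ℝ) 1, ∀ t ∈ Icc (0 : ℝ) 1,
    ∫ ω, B s ω * B t ω ∂P = (s ^ (2 * H) + t ^ (2 * H) - |t - s| ^ (2 * H)) / 2
  continuous_paths : ∀ᵐ ω ∂P, ContinuousOn (fun t => B t ω) (Icc 0 1)

/-- The Riemann-Stieltjes integral of `f` with respect to `g` over `[s,t]` (where `s ≤ t`) exists
and equals `I`: the sums `∑ f(ξ_i) (g(u_{i+1}) - g(u_i))` over tagged partitions
`s = u_0 ≤ u_1 ≤ ... ≤ u_m = t`, `ξ_i ∈ [u_i, u_{i+1}]`, converge to `I` as the mesh tends to `0`. -/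
def HasRSIntegral (f g : ℝ → ℝ) (s t I : ℝ) : Prop :=
  ∀ ε > 0, ∃ δ > 0, ∀ (m : ℕ) (u ξ : ℕ → ℝ), u 0 = s → u m = t →
    (∀ i < m, u i ≤ ξ i ∧ ξ i ≤ u (i + 1) ∧ u (i + 1) - u i < δ) →
    |∑ i ∈ Finset.range m, f (ξ i) * (g (u (i + 1)) - g (u i)) - I| < ε

/-- There are partitions of arbitrarily small mesh, so the Riemann-Stieltjes integral is unique. -/
theorem HasRSIntegral.unique {f g : ℝ → ℝ} {s t I J : ℝ} (hst : s ≤ t)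
    (hI : HasRSIntegral f g s t I) (hJ : HasRSIntegral f g s t J) : I = J := by
  by_contra hne
  have hpos : 0 < |I - J| / 2 := half_pos (abs_pos.mpr (sub_ne_zero.mpr hne))
  obtain ⟨δ₁, hδ₁, h₁⟩ := hI _ hpos
  obtain ⟨δ₂, hδ₂, h₂⟩ := hJ _ hpos
  have hδ : 0 < min δ₁ δ₂ := lt_min hδ₁ hδ₂
  obtain ⟨m, hm⟩ := exists_nat_gt ((t - s) / min δ₁ δ₂)
  have hm0 : (0 : ℝ) < m := lt_of_le_of_lt (div_nonneg (sub_nonneg.mpr hst) hδ.le) hm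
  have hmesh : (t - s) / m < min δ₁ δ₂ := by
    rw [div_lt_iff₀ hδ] at hm
    rw [div_lt_iff₀ hm0]
    linarith
  have hnn : 0 ≤ (t - s) / m := div_nonneg (sub_nonneg.mpr hst) hm0.le
  set u : ℕ → ℝ := fun i => s + i * ((t - s) / m) with hu
  have hstep : ∀ i : ℕ, u (i + 1) - u i = (t - s) / m := by
    intro i
    simp only [hu]
    push_cast
    ring
  have h0 : u 0 = s := by simp [hu]
  have hend : u m = t := by
    simp only [hu]
    field_simp
    ring
  have e₁ := h₁ m u u h0 hend (fun i _ => ⟨le_rfl, by linarith [hstep i],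
    by rw [hstep i]; exact lt_of_lt_of_le hmesh (min_le_left _ _)⟩)
  have e₂ := h₂ m u u h0 hend (fun i _ => ⟨le_rfl, by linarith [hstep i],
    by rw [hstep i]; exact lt_of_lt_of_le hmesh (min_le_right _ _)⟩)
  rw [abs_sub_comm] at e₁
  have := abs_sub_le I (∑ i ∈ Finset.range m, f (u i) * (g (u (i + 1)) - g (u i))) J
  linarith

open Classical in
/-- The Riemann-Stieltjes integral `∫_s^t f dg` for `s ≤ t` (with value `0` if it does not
exist). -/
def rsIntegral (f g : ℝ → ℝ) (s t : ℝ) : ℝ :=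
  if h : ∃ I, HasRSIntegral f g s t I then h.choose else 0

/-- The path `x` solves `dx_t = a(x_t) dt + σ(x_t) db_t`, `x_0 = x₀`, on `[0,1]`, where `b` is a
deterministic driving path: `x` is continuous and for every `t ∈ [0,1]` the Riemann-Stieltjes
integral `∫_0^t σ(x_τ) db_τ` exists and
`x_t = x₀ + ∫_0^t a(x_τ) dτ + ∫_0^t σ(x_τ) db_τ`. -/
def IsPathwiseSolution (a σ : ℝ → ℝ) (x₀ : ℝ) (b x : ℝ → ℝ) : Prop :=
  ContinuousOn x (Icc 0 1) ∧ ∀ t ∈ Icc (0 : ℝ) 1, ∃ I,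
    HasRSIntegral (fun τ => σ (x τ)) b 0 t I ∧ x t = x₀ + (∫ τ in (0 : ℝ)..t, a (x τ)) + I

/-- Piecewise linear interpolation of the path `b` with stepsize `1/n`, for `n ≥ 1` and `t ≥ 0`:
for `t ∈ [k/n, (k+1)/n]` it is `b_{k/n} + (nt - k) (b_{(k+1)/n} - b_{k/n})`. -/
def linearInterpolation (n : ℕ) (b : ℝ → ℝ) (t : ℝ) : ℝ :=
  b ((⌊n * t⌋₊ : ℝ) / n) +
    (n * t - (⌊n * t⌋₊ : ℝ)) * (b (((⌊n * t⌋₊ : ℝ) + 1) / n) - b ((⌊n * t⌋₊ : ℝ) / n))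

/-- The weight function
`𝒴_t = (a σ' - a' σ)(x_t) exp (∫_t^1 a'(x_s) ds + ∫_t^1 σ'(x_s) db_s)` along a path `x` driven by
`b`. -/
def weightFunction (a σ : ℝ → ℝ) (b x : ℝ → ℝ) (t : ℝ) : ℝ :=
  (a (x t) * deriv σ (x t) - deriv a (x t) * σ (x t)) *
    Real.exp ((∫ s in t..1, deriv a (x s)) + rsIntegral (fun s => deriv σ (x s)) b t 1)

/-- The weighted integral `∫_0^1 𝒴_t (b_t - b̃_t) dt` of the interpolation error of `b`. -/
def weightedInterpolationError (a σ : ℝ → ℝ) (b x : ℝ → ℝ) (n : ℕ) : ℝ :=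
  ∫ t in (0 : ℝ)..1, weightFunction a σ b x t * (b t - linearInterpolation n b t)

end

/-! Write F for the Lamperti transform, F' = 1/σ. Along a solution the chain rule gives F(X_t) =
F(x₀) + ∫_0^t (a/σ)(X_s) ds + B_t - B_0, so the noise becomes additive; the same holds for the
interpolated noise (`IsPathwiseSolution.lamperti_eq`). A solution is only assumed continuous, with
existing Riemann-Stieltjes integrals. The chain rule therefore rests on the Saks-Henstock lemma,
which makes the sum of the absolute local errors small, and on Hölder paths of order β > 1/2, whose
squared increments sum to o(1).

Let e = B - B̃, which vanishes at 0 and 1. The difference of the two transformed solutions is v + e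
with v differentiable, v' = γ(v + e) + O((v + e)²), where γ_t is `lampertiSlope` at X_t. Gronwall
gives v² = O(Q) with Q = ∫ e², and variation of constants gives v_1 = ∫ exp(∫_t^1 γ) γ_t e_t dt +
O(Q). Since e_1 = 0, expanding the inverse of F at time 1 yields X_1 - X̃_1 = `linearizedError` +
O(Q), with deterministic constants (`CoefficientBounds.exists_error_bound`).

The chain rule for log σ(X) evaluates ∫_t^1 σ'(X) dB and turns the weight into 𝒴_t = -σ(X_1) γ_t
exp(∫_t^1 γ). The weighted error is thus minus the linearized error, and the sign is lost in the
squares.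

Gaussian scaling gives ‖e_t‖_4 = O(n^{-H}), hence ‖Q‖_2 = O(n^{-2H}). The root-mean-square estimate
is the reverse triangle inequality in L². The mean-square estimate needs no cancellation, since both
second moments are O(E Q) (`mean_square_comparison`). -/

/-! ### Riemann-Stieltjes sums and the Saks-Henstock lemma. -/

/-- `S` is a Riemann-Stieltjes sum of `f` against `g` over a tagged partition of `[s, t]` of mesh
less than `δ`. -/
inductive IsRSSum (f g : ℝ → ℝ) (δ s : ℝ) : ℝ → ℝ → Prop
  | refl : IsRSSum f g δ s s 0
  | snoc {t S : ℝ} (r ξ : ℝ) : IsRSSum f g δ s t S → t ≤ ξ → ξ ≤ r → r - t < δ →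
      IsRSSum f g δ s r (S + f ξ * (g r - g t))

namespace IsRSSum

variable {f g : ℝ → ℝ} {δ s t r S S' : ℝ}

theorem trans (h : IsRSSum f g δ s t S) (h' : IsRSSum f g δ t r S') :
    IsRSSum f g δ s r (S + S') := by
  induction h' with
  | refl => simpa using h
  | snoc r ξ _ h1 h2 h3 ih =>
    rw [← add_assoc]
    exact ih.snoc r ξ h1 h2 h3

theorem single {ξ : ℝ} (h1 : s ≤ ξ) (h2 : ξ ≤ t) (h3 : t - s < δ) :
    IsRSSum f g δ s t (f ξ * (g t - g s)) := by
  simpa using (IsRSSum.refl (f := f) (g := g) (δ := δ) (s := s)).snoc t ξ h1 h2 h3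

theorem mono {δ' : ℝ} (h : IsRSSum f g δ s t S) (hδ : δ ≤ δ') : IsRSSum f g δ' s t S := by
  induction h with
  | refl => exact .refl
  | snoc r ξ _ h1 h2 h3 ih => exact ih.snoc r ξ h1 h2 (h3.trans_le hδ)

theorem exists_seq (h : IsRSSum f g δ s t S) : ∃ (m : ℕ) (u ξ : ℕ → ℝ), u 0 = s ∧ u m = t ∧
    (∀ i < m, u i ≤ ξ i ∧ ξ i ≤ u (i + 1) ∧ u (i + 1) - u i < δ) ∧
    S = ∑ i ∈ Finset.range m, f (ξ i) * (g (u (i + 1)) - g (u i)) := by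
  induction h with
  | refl => exact ⟨0, fun _ => s, fun _ => s, rfl, rfl, by simp, by simp⟩
  | @snoc t S r ξ _ h1 h2 h3 ih =>
    obtain ⟨m, u, η, hu0, hum, hmesh, hS⟩ := ih
    refine ⟨m + 1, fun i => if i ≤ m then u i else r, fun i => if i < m then η i else ξ,
      by simp [hu0], by simp, ?_, ?_⟩
    · intro i hi
      rcases Nat.lt_succ_iff_lt_or_eq.1 hi with hi | rfl
      · simpa [hi, hi.le, Nat.succ_le_of_lt hi] using hmesh i hi
      · simpa [hum] using ⟨h1, h2, h3⟩
    · rw [Finset.sum_range_succ, hS]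
      congr 1
      · refine Finset.sum_congr rfl fun i hi => ?_
        have hi := Finset.mem_range.1 hi
        simp [hi, hi.le, Nat.succ_le_of_lt hi]
      · simp [hum]

theorem exists_of_le (f g : ℝ → ℝ) (hδ : 0 < δ) (hst : s ≤ t) : ∃ S, IsRSSum f g δ s t S := by
  obtain ⟨m, hm⟩ := exists_nat_gt ((t - s) / δ)
  have hm0 : (0 : ℝ) < m := (div_nonneg (sub_nonneg.2 hst) hδ.le).trans_lt hm
  have hh : (t - s) / m < δ := by
    rw [div_lt_iff₀ hδ] at hm
    rw [div_lt_iff₀ hm0]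
    linarith
  have hnn : 0 ≤ (t - s) / m := div_nonneg (sub_nonneg.2 hst) hm0.le
  have key : ∀ i : ℕ, ∃ S, IsRSSum f g δ s (s + i * ((t - s) / m)) S := by
    intro i
    induction i with
    | zero => exact ⟨0, by simpa using IsRSSum.refl⟩
    | succ i ih =>
      obtain ⟨S, hS⟩ := ih
      refine ⟨_, hS.snoc (s + (i + 1 : ℕ) * ((t - s) / m)) _ le_rfl ?_ ?_⟩ <;>
        push_cast <;> linarith
  have := key m
  rwa [mul_div_cancel₀ _ hm0.ne', add_sub_cancel] at this

theorem sum (u : ℕ → ℝ) (S : ℕ → ℝ) (m : ℕ)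
    (h : ∀ i < m, IsRSSum f g δ (u i) (u (i + 1)) (S i)) :
    IsRSSum f g δ (u 0) (u m) (∑ i ∈ Finset.range m, S i) := by
  induction m with
  | zero => simpa using IsRSSum.refl
  | succ m ih =>
    rw [Finset.sum_range_succ]
    exact (ih fun i hi => h i (hi.trans (Nat.lt_succ_self m))).trans (h m (Nat.lt_succ_self m))

end IsRSSum

theorem HasRSIntegral.exists_mesh {f g : ℝ → ℝ} {s t I : ℝ} (h : HasRSIntegral f g s t I)
    {ε : ℝ} (hε : 0 < ε) : ∃ δ > 0, ∀ S, IsRSSum f g δ s t S → |S - I| < ε := by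
  obtain ⟨δ, hδ, H⟩ := h ε hε
  refine ⟨δ, hδ, fun S hS => ?_⟩
  obtain ⟨m, u, ξ, h0, hm, hu, rfl⟩ := hS.exists_seq
  exact H m u ξ h0 hm hu

theorem HasRSIntegral.eq_zero {f g : ℝ → ℝ} {s I : ℝ} (h : HasRSIntegral f g s s I) : I = 0 := by
  refine abs_eq_zero.1 (le_antisymm (le_of_forall_pos_le_add fun η hη => ?_) (abs_nonneg _))
  obtain ⟨δ, -, H⟩ := h.exists_mesh hη
  have := H 0 .refl
  rw [zero_sub, abs_neg] at this
  linarith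

/-- Existence of the integral over `[s, t]` is not assumed. Appending a fine partition of `[s, t]`
to a fine one of `[r, s]` gives a fine partition of `[r, t]`, and the two known limits are
subtracted. -/
theorem HasRSIntegral.exists_sum_near {f g : ℝ → ℝ} {r s t I J : ℝ} (hrs : r ≤ s) (hst : s ≤ t)
    (hI : HasRSIntegral f g r s I) (hJ : HasRSIntegral f g r t J)
    {δ η : ℝ} (hδ : 0 < δ) (hη : 0 < η) :
    ∃ S, IsRSSum f g δ s t S ∧ |S - (J - I)| < η := by
  obtain ⟨δ₁, hδ₁, H₁⟩ := hI.exists_mesh (half_pos hη)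
  obtain ⟨δ₂, hδ₂, H₂⟩ := hJ.exists_mesh (half_pos hη)
  have hm : 0 < min δ (min δ₁ δ₂) := lt_min hδ (lt_min hδ₁ hδ₂)
  obtain ⟨S, hS⟩ := IsRSSum.exists_of_le f g hm hst
  obtain ⟨S₀, hS₀⟩ := IsRSSum.exists_of_le f g hm hrs
  refine ⟨S, hS.mono (min_le_left _ _), ?_⟩
  have e₁ := H₁ S₀ (hS₀.mono ((min_le_right _ _).trans (min_le_left _ _)))
  have e₂ := H₂ _ ((hS₀.trans hS).mono ((min_le_right _ _).trans (min_le_right _ _)))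
  rw [abs_lt] at *
  constructor <;> linarith [e₁.1, e₁.2, e₂.1, e₂.2]

/-- The Saks-Henstock lemma for Riemann-Stieltjes integrals. -/
theorem HasRSIntegral.saks_henstock {f g J : ℝ → ℝ} {s t : ℝ}
    (hJ : ∀ r ∈ Icc s t, HasRSIntegral f g s r (J r)) {ε : ℝ} (hε : 0 < ε) (hst : s ≤ t) :
    ∃ δ > 0, ∀ (m : ℕ) (u : ℕ → ℝ), Monotone u → u 0 = s → u m = t →
      (∀ i < m, u (i + 1) - u i < δ) →
      ∑ i ∈ Finset.range m, |J (u (i + 1)) - J (u i) - f (u i) * (g (u (i + 1)) - g (u i))|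
        ≤ ε := by
  obtain ⟨δ, hδ, H⟩ := (hJ t ⟨hst, le_rfl⟩).exists_mesh (half_pos hε)
  refine ⟨δ, hδ, fun m u hu h0 hm hmesh => ?_⟩
  have hJs : J s = 0 := (hJ s ⟨le_rfl, hst⟩).eq_zero
  set ρ : ℕ → ℝ := fun i => J (u (i + 1)) - J (u i) - f (u i) * (g (u (i + 1)) - g (u i)) with hρ
  have hmem : ∀ i ≤ m, u i ∈ Icc s t := fun i hi =>
    ⟨h0 ▸ hu (Nat.zero_le i), hm ▸ hu hi⟩
  -- Use the left-endpoint term on the intervals of `Q` and a sum almost equal to the increment of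
  -- `J` on the others. The whole is still a fine sum over `[s, t]`, so it is close to `J t`, and
  -- only the errors on `Q` remain. Taking for `Q` the indices with `ρ ≥ 0` and those with `ρ < 0`
  -- then bounds the sum of absolute values.
  have key : ∀ Q : Set ℕ, |∑ i ∈ Finset.range m, Q.indicator ρ i| ≤ ε / 2 := by
    classical
    intro Q
    refine le_of_forall_pos_le_add fun η hη => ?_
    have hη' : 0 < η / (m + 1) := by positivity
    have hS : ∀ i, ∃ S, i < m → IsRSSum f g δ (u i) (u (i + 1)) S ∧
        |S - (J (u (i + 1)) - J (u i)) + Q.indicator ρ i| ≤ η / (m + 1) := by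
      intro i
      by_cases hi : i < m
      swap
      · exact ⟨0, fun h => absurd h hi⟩
      by_cases hQ : i ∈ Q
      · refine ⟨f (u i) * (g (u (i + 1)) - g (u i)), fun _ =>
          ⟨.single le_rfl (hu (Nat.le_succ i)) (hmesh i hi), ?_⟩⟩
        simp only [indicator_of_mem hQ, hρ]
        ring_nf
        simpa [abs_zero] using by positivity
      · obtain ⟨S, h1, h2⟩ := (hJ _ (hmem i hi.le)).exists_sum_near (hmem i hi.le).1
          (hu (Nat.le_succ i)) (hJ _ (hmem (i + 1) hi)) hδ hη'
        refine ⟨S, fun _ => ⟨h1, ?_⟩⟩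
        simpa [indicator_of_notMem hQ] using h2.le
    choose S hS using hS
    have h1 := H _ (h0 ▸ hm ▸ IsRSSum.sum u S m fun i hi => (hS i hi).1)
    have h2 : ∑ i ∈ Finset.range m, (J (u (i + 1)) - J (u i)) = J t := by
      rw [Finset.sum_range_sub (fun i => J (u i)), h0, hm, hJs, sub_zero]
    have h3 : |∑ i ∈ Finset.range m, (S i - (J (u (i + 1)) - J (u i)) + Q.indicator ρ i)| ≤ η := by
      refine (Finset.abs_sum_le_sum_abs _ _).trans ((Finset.sum_le_sum fun i hi =>
        (hS i (Finset.mem_range.1 hi)).2).trans ?_)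
      rw [Finset.sum_const, Finset.card_range, nsmul_eq_mul, mul_div_assoc',
        div_le_iff₀ (by positivity)]
      nlinarith
    rw [Finset.sum_add_distrib, Finset.sum_sub_distrib, h2] at h3
    rw [abs_le] at *
    rw [abs_lt] at h1
    constructor <;> linarith [h1.1, h1.2, h3.1, h3.2]
  have hsplit : ∀ i, |ρ i| = {j | 0 ≤ ρ j}.indicator ρ i - {j | ρ j < 0}.indicator ρ i := by
    intro i
    rcases le_or_gt 0 (ρ i) with h | h
    · rw [indicator_of_mem (by exact h), indicator_of_notMem (by simpa using h), abs_of_nonneg h,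
        sub_zero]
    · rw [indicator_of_notMem (by simpa using h), indicator_of_mem (by exact h), abs_of_neg h,
        zero_sub]
  change ∑ i ∈ Finset.range m, |ρ i| ≤ ε
  simp_rw [hsplit]
  rw [Finset.sum_sub_distrib]
  have k1 := abs_le.1 (key {j | 0 ≤ ρ j})
  have k2 := abs_le.1 (key {j | ρ j < 0})
  linarith [k1.2, k2.1]

/-! ### Coefficient bounds and calculus in the Lamperti coordinate. -/

/-- The bounds on the coefficients of the equation that enter all estimates. -/
structure CoefficientBounds (a σ : ℝ → ℝ) (M : ℝ) : Prop where
  pos : ∀ x, 0 < σ x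
  le : ∀ x, |σ x| ≤ M
  inv_le : ∀ x, |(σ x)⁻¹| ≤ M
  hasDerivAt : ∀ x, HasDerivAt σ (deriv σ x) x
  deriv_le : ∀ x, |deriv σ x| ≤ M
  deriv_lip : ∀ x y, |deriv σ x - deriv σ y| ≤ M * |x - y|
  drift_le : ∀ x, |a x| ≤ M
  drift_hasDerivAt : ∀ x, HasDerivAt a (deriv a x) x
  drift_deriv_le : ∀ x, |deriv a x| ≤ M
  drift_deriv_lip : ∀ x y, |deriv a x - deriv a y| ≤ M * |x - y|

theorem abs_sub_le_of_hasDerivAt {f f' : ℝ → ℝ} {M : ℝ} (hf : ∀ x, HasDerivAt f (f' x) x)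
    (hM : ∀ x, |f' x| ≤ M) (x y : ℝ) : |f x - f y| ≤ M * |x - y| := by
  simpa [Real.norm_eq_abs] using Convex.norm_image_sub_le_of_norm_hasDerivWithin_le
    (f := f) (f' := f') (s := Set.univ) (fun z _ => (hf z).hasDerivWithinAt) (fun z _ => hM z)
    convex_univ (mem_univ y) (mem_univ x)

theorem continuous_of_abs_sub_le {f : ℝ → ℝ} {M : ℝ} (hf : ∀ x y, |f x - f y| ≤ M * |x - y|) :
    Continuous f :=
  (LipschitzWith.of_dist_le_mul (K := M.toNNReal) fun x y => by
    rw [Real.dist_eq, Real.dist_eq]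
    exact (hf x y).trans (mul_le_mul_of_nonneg_right (Real.le_coe_toNNReal M)
      (abs_nonneg _))).continuous

theorem abs_mul_sub_mul_le {A B K L d p q p' q' : ℝ} (hq : |q| ≤ B) (hp' : |p'| ≤ A)
    (h1 : |p - p'| ≤ K * d) (h2 : |q - q'| ≤ L * d) :
    |p * q - p' * q'| ≤ (K * B + A * L) * d := by
  have e : p * q - p' * q' = (p - p') * q + p' * (q - q') := by ring
  have i1 : |(p - p') * q| ≤ K * d * B := by
    rw [abs_mul]
    exact mul_le_mul h1 hq (abs_nonneg _) ((abs_nonneg _).trans h1)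
  have i2 : |p' * (q - q')| ≤ A * (L * d) := by
    rw [abs_mul]
    exact mul_le_mul hp' h2 (abs_nonneg _) ((abs_nonneg _).trans hp')
  rw [e]
  refine (abs_add_le _ _).trans ?_
  linarith

noncomputable section

/-- The Lamperti transform `x ↦ ∫_0^x dy / σ(y)`. -/
def lamperti (σ : ℝ → ℝ) (x : ℝ) : ℝ := ∫ y in (0 : ℝ)..x, (σ y)⁻¹

/-- The derivative, in the Lamperti coordinate, of the drift `a / σ`. -/
def lampertiSlope (a σ : ℝ → ℝ) (x : ℝ) : ℝ := deriv a x - a x * deriv σ x * (σ x)⁻¹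

end

/-- Cauchy's mean value theorem. With `F` the Lamperti transform and `w = 1/σ`, the factor `ψ` is
the derivative of `φ` in the Lamperti coordinate, so the inverse of `F` need not be constructed. -/
theorem exists_sub_eq_mul_sub {F φ w ψ : ℝ → ℝ} (hw : ∀ x, 0 < w x)
    (hF : ∀ x, HasDerivAt F (w x) x) (hφ : ∀ x, HasDerivAt φ (ψ x * w x) x) (x y : ℝ) :
    ∃ ξ ∈ uIcc x y, φ y - φ x = ψ ξ * (F y - F x) := by
  wlog hxy : x < y generalizing x y
  · rcases (not_lt.1 hxy).eq_or_lt with rfl | h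
    · exact ⟨y, by simp, by simp⟩
    · obtain ⟨ξ, h1, h2⟩ := this y x h
      exact ⟨ξ, uIcc_comm x y ▸ h1, by linear_combination -h2⟩
  obtain ⟨ξ, h1, h2⟩ := exists_ratio_hasDerivAt_eq_ratio_slope F w hxy
    (fun z _ => (hF z).continuousAt.continuousWithinAt) (fun z _ => hF z) φ (fun z => ψ z * w z)
    (fun z _ => (hφ z).continuousAt.continuousWithinAt) (fun z _ => hφ z)
  refine ⟨ξ, Icc_subset_uIcc (Ioo_subset_Icc_self h1), ?_⟩
  have := (hw ξ).ne'
  field_simp at h2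
  linarith

namespace CoefficientBounds

variable {a σ : ℝ → ℝ} {M : ℝ}

theorem nonneg (h : CoefficientBounds a σ M) : 0 ≤ M := (abs_nonneg _).trans (h.le 0)

theorem continuous (h : CoefficientBounds a σ M) : Continuous σ :=
  continuous_iff_continuousAt.2 fun x => (h.hasDerivAt x).continuousAt

theorem continuous_inv (h : CoefficientBounds a σ M) : Continuous fun x => (σ x)⁻¹ :=
  h.continuous.inv₀ fun x => (h.pos x).ne'

theorem drift_continuous (h : CoefficientBounds a σ M) : Continuous a :=
  continuous_iff_continuousAt.2 fun x => (h.drift_hasDerivAt x).continuousAt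

theorem deriv_continuous (h : CoefficientBounds a σ M) : Continuous (deriv σ) :=
  continuous_of_abs_sub_le h.deriv_lip

theorem drift_deriv_continuous (h : CoefficientBounds a σ M) : Continuous (deriv a) :=
  continuous_of_abs_sub_le h.drift_deriv_lip

theorem slope_continuous (h : CoefficientBounds a σ M) : Continuous (lampertiSlope a σ) :=
  h.drift_deriv_continuous.sub ((h.drift_continuous.mul h.deriv_continuous).mul h.continuous_inv)

theorem lamperti_hasDerivAt (h : CoefficientBounds a σ M) (x : ℝ) :
    HasDerivAt (lamperti σ) (σ x)⁻¹ x :=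
  intervalIntegral.integral_hasDerivAt_right (h.continuous_inv.intervalIntegrable _ _)
    (h.continuous_inv.stronglyMeasurableAtFilter _ _) h.continuous_inv.continuousAt

theorem inv_pos (h : CoefficientBounds a σ M) (x : ℝ) : 0 < (σ x)⁻¹ := _root_.inv_pos.2 (h.pos x)

theorem inv_lip (h : CoefficientBounds a σ M) (x y : ℝ) :
    |(σ x)⁻¹ - (σ y)⁻¹| ≤ M ^ 3 * |x - y| := by
  have e : (σ x)⁻¹ - (σ y)⁻¹ = (σ x)⁻¹ * (σ y)⁻¹ * (σ y - σ x) := by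
    have := (h.pos x).ne'
    have := (h.pos y).ne'
    field_simp
  rw [e, abs_mul, abs_mul, abs_sub_comm (σ y)]
  calc |(σ x)⁻¹| * |(σ y)⁻¹| * |σ x - σ y| ≤ M * M * (M * |x - y|) := by
        have := h.nonneg
        gcongr
        · exact h.inv_le x
        · exact h.inv_le y
        · exact abs_sub_le_of_hasDerivAt h.hasDerivAt h.deriv_le x y
    _ = _ := by ring

theorem slope_lip (h : CoefficientBounds a σ M) : ∃ L, 0 ≤ L ∧ ∀ x y,
    |lampertiSlope a σ x - lampertiSlope a σ y| ≤ L * |x - y| := by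
  have hM := h.nonneg
  refine ⟨M + ((M * M + M * M) * M + M * M * M ^ 3), by positivity, fun x y => ?_⟩
  have h1 := abs_mul_sub_mul_le (h.deriv_le x) (h.drift_le y)
    (abs_sub_le_of_hasDerivAt h.drift_hasDerivAt h.drift_deriv_le x y) (h.deriv_lip x y)
  have h2 := abs_mul_sub_mul_le (h.inv_le x) (p' := a y * deriv σ y) (A := M * M)
    (by rw [abs_mul]; exact mul_le_mul (h.drift_le y) (h.deriv_le y) (abs_nonneg _) hM)
    h1 (h.inv_lip x y)
  have h3 := h.drift_deriv_lip x y
  have e : lampertiSlope a σ x - lampertiSlope a σ y = (deriv a x - deriv a y)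
    - (a x * deriv σ x * (σ x)⁻¹ - a y * deriv σ y * (σ y)⁻¹) := by
    simp only [lampertiSlope]
    ring
  rw [e]
  refine (abs_sub _ _).trans ?_
  linarith

theorem slope_le (h : CoefficientBounds a σ M) (x : ℝ) :
    |lampertiSlope a σ x| ≤ M + M * M * M := by
  have hM := h.nonneg
  refine (abs_sub _ _).trans (add_le_add (h.drift_deriv_le x) ?_)
  rw [abs_mul, abs_mul]
  gcongr
  exacts [h.drift_le x, h.deriv_le x, h.inv_le x]

theorem drift_div_hasDerivAt (h : CoefficientBounds a σ M) (x : ℝ) :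
    HasDerivAt (fun x => a x * (σ x)⁻¹) (lampertiSlope a σ x * (σ x)⁻¹) x := by
  refine ((h.drift_hasDerivAt x).mul ((h.hasDerivAt x).fun_inv (h.pos x).ne')).congr_deriv ?_
  have := (h.pos x).ne'
  simp only [lampertiSlope]
  field_simp
  ring

/-- In the Lamperti coordinate `log σ` has slope `σ'`. This is what makes the integral of `σ'(X)`
against the noise explicit. -/
theorem log_hasDerivAt (h : CoefficientBounds a σ M) (x : ℝ) :
    HasDerivAt (fun x => Real.log (σ x)) (deriv σ x * (σ x)⁻¹) x :=
  (h.hasDerivAt x).log (h.pos x).ne'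

theorem abs_sub_le_lamperti (h : CoefficientBounds a σ M) (x y : ℝ) :
    |x - y| ≤ M * |lamperti σ x - lamperti σ y| := by
  obtain ⟨ξ, -, h2⟩ := exists_sub_eq_mul_sub h.inv_pos h.lamperti_hasDerivAt (φ := id) (ψ := σ)
    (fun x => by simpa [(h.pos x).ne'] using hasDerivAt_id x) y x
  simp only [id] at h2
  rw [h2, abs_mul]
  exact mul_le_mul_of_nonneg_right (h.le ξ) (abs_nonneg _)

/-- First order expansion in the Lamperti coordinate. -/
theorem taylor (h : CoefficientBounds a σ M) {φ ψ : ℝ → ℝ} {L : ℝ}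
    (hφ : ∀ x, HasDerivAt φ (ψ x * (σ x)⁻¹) x) (hL : 0 ≤ L)
    (hψ : ∀ x y, |ψ x - ψ y| ≤ L * |x - y|) (x y : ℝ) :
    |φ y - φ x - ψ x * (lamperti σ y - lamperti σ x)|
      ≤ L * M * (lamperti σ y - lamperti σ x) ^ 2 := by
  obtain ⟨ξ, h1, h2⟩ := exists_sub_eq_mul_sub h.inv_pos h.lamperti_hasDerivAt hφ x y
  rw [h2, ← sub_mul, abs_mul, ← sq_abs (lamperti σ y - _)]
  have h3 : |ψ ξ - ψ x| ≤ L * (M * |lamperti σ y - lamperti σ x|) :=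
    (hψ ξ x).trans (mul_le_mul_of_nonneg_left ((abs_sub_left_of_mem_uIcc h1).trans
      (h.abs_sub_le_lamperti y x)) hL)
  calc _ ≤ L * (M * |lamperti σ y - lamperti σ x|) * |lamperti σ y - lamperti σ x| :=
        mul_le_mul_of_nonneg_right h3 (abs_nonneg _)
    _ = _ := by ring

theorem lamperti_taylor (h : CoefficientBounds a σ M) (x y : ℝ) :
    |lamperti σ y - lamperti σ x - (σ x)⁻¹ * (y - x)| ≤ M ^ 3 * (y - x) ^ 2 := by
  obtain ⟨ξ, h1, h2⟩ := exists_sub_eq_mul_sub (F := id) (w := fun _ => 1) (fun _ => one_pos)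
    hasDerivAt_id (φ := lamperti σ) (ψ := fun x => (σ x)⁻¹)
    (fun x => by simpa using h.lamperti_hasDerivAt x) x y
  simp only [id] at h2
  rw [h2, ← sub_mul, abs_mul, ← sq_abs (y - x)]
  have h3 : |(σ ξ)⁻¹ - (σ x)⁻¹| ≤ M ^ 3 * |y - x| :=
    (h.inv_lip ξ x).trans (mul_le_mul_of_nonneg_left (abs_sub_left_of_mem_uIcc h1)
      (pow_nonneg h.nonneg 3))
  calc _ ≤ M ^ 3 * |y - x| * |y - x| := mul_le_mul_of_nonneg_right h3 (abs_nonneg _)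
    _ = _ := by ring

end CoefficientBounds

theorem exists_coefficientBounds {a σ : ℝ → ℝ}
    (ha : ContDiff ℝ 2 a) (ha_bdd : ∀ k ≤ 2, ∃ M, ∀ x, |iteratedDeriv k a x| ≤ M)
    (hσ : ContDiff ℝ 2 σ) (hσ_bdd : ∀ k ≤ 2, ∃ M, ∀ x, |iteratedDeriv k σ x| ≤ M)
    (hσ_pos : ∃ c > 0, ∀ x, c ≤ σ x) : ∃ M, CoefficientBounds a σ M := by
  obtain ⟨c, hc, hcσ⟩ := hσ_pos
  obtain ⟨A0, hA0⟩ := ha_bdd 0 (by norm_num)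
  obtain ⟨A1, hA1⟩ := ha_bdd 1 (by norm_num)
  obtain ⟨A2, hA2⟩ := ha_bdd 2 (by norm_num)
  obtain ⟨S0, hS0⟩ := hσ_bdd 0 (by norm_num)
  obtain ⟨S1, hS1⟩ := hσ_bdd 1 (by norm_num)
  obtain ⟨S2, hS2⟩ := hσ_bdd 2 (by norm_num)
  simp only [iteratedDeriv_zero, iteratedDeriv_one] at hA0 hA1 hS0 hS1
  have n1 : 0 ≤ A0 := (abs_nonneg _).trans (hA0 0)
  have n2 : 0 ≤ A1 := (abs_nonneg _).trans (hA1 0)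
  have n3 : 0 ≤ A2 := (abs_nonneg _).trans (hA2 0)
  have n4 : 0 ≤ S0 := (abs_nonneg _).trans (hS0 0)
  have n5 : 0 ≤ S1 := (abs_nonneg _).trans (hS1 0)
  have n6 : 0 ≤ S2 := (abs_nonneg _).trans (hS2 0)
  have n7 : 0 < c⁻¹ := inv_pos.2 hc
  have lip : ∀ {f : ℝ → ℝ} {L : ℝ}, ContDiff ℝ 2 f → (∀ x, |iteratedDeriv 2 f x| ≤ L) →
      ∀ x y, |deriv f x - deriv f y| ≤ L * |x - y| := by
    intro f L hf hL
    have hd : Differentiable ℝ (deriv f) := by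
      have := hf.differentiable_iteratedDeriv 1 (by norm_num)
      rwa [iteratedDeriv_one] at this
    refine abs_sub_le_of_hasDerivAt (fun x => (hd x).hasDerivAt) fun x => ?_
    have := hL x
    rwa [iteratedDeriv_succ, iteratedDeriv_one] at this
  refine ⟨A0 + A1 + A2 + S0 + S1 + S2 + c⁻¹, ⟨fun x => hc.trans_le (hcσ x),
    fun x => (hS0 x).trans (by linarith), fun x => ?_,
    fun x => (hσ.differentiable (by norm_num) x).hasDerivAt,
    fun x => (hS1 x).trans (by linarith), fun x y => (lip hσ hS2 x y).trans
      (mul_le_mul_of_nonneg_right (by linarith) (abs_nonneg _)),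
    fun x => (hA0 x).trans (by linarith),
    fun x => (ha.differentiable (by norm_num) x).hasDerivAt,
    fun x => (hA1 x).trans (by linarith), fun x y => (lip ha hA2 x y).trans
      (mul_le_mul_of_nonneg_right (by linarith) (abs_nonneg _))⟩⟩
  rw [abs_of_pos (inv_pos.2 (hc.trans_le (hcσ x)))]
  exact (inv_anti₀ hc (hcσ x)).trans (by linarith)

theorem eq_zero_of_forall_abs_le_mul {x C : ℝ} (h : ∀ ε, 0 < ε → ε ≤ 1 → |x| ≤ C * ε) : x = 0 := by
  by_contra hx
  have hx' : 0 < |x| := abs_pos.2 hx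
  have hC : 0 < C := by
    have := h 1 one_pos le_rfl
    linarith
  have h1 := h (min 1 (|x| / (2 * C))) (by positivity) (min_le_left _ _)
  have h2 : C * min 1 (|x| / (2 * C)) ≤ C * (|x| / (2 * C)) :=
    mul_le_mul_of_nonneg_left (min_le_right _ _) hC.le
  have h3 : C * (|x| / (2 * C)) = |x| / 2 := by field_simp
  linarith

theorem add_add_sq_le (x y z : ℝ) : (x + y + z) ^ 2 ≤ 3 * (x ^ 2 + y ^ 2 + z ^ 2) := by
  nlinarith [sq_nonneg (x - y), sq_nonneg (y - z), sq_nonneg (x - z)]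

namespace CoefficientBounds

variable {a σ : ℝ → ℝ} {M : ℝ}

/-- One step of the chain rule from `p` to `q`: `A` stands for the drift contribution in the
original coordinate, `A'` for that in the Lamperti coordinate, `d` for the noise increment, and `q -
p - A - σ p * d` is the local error of the equation. -/
theorem lamperti_increment (h : CoefficientBounds a σ M) (p q A A' d : ℝ) :
    |lamperti σ q - lamperti σ p - A' - d| ≤ |A' - (σ p)⁻¹ * A| + M * |q - p - A - σ p * d|
      + 3 * M ^ 3 * (A ^ 2 + M ^ 2 * d ^ 2 + (q - p - A - σ p * d) ^ 2) := by
  set ρ := q - p - A - σ p * d with hρ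
  have hM := h.nonneg
  have hσ := (h.pos p).ne'
  have e : lamperti σ q - lamperti σ p - A' - d = (lamperti σ q - lamperti σ p - (σ p)⁻¹ * (q - p))
      + (-(A' - (σ p)⁻¹ * A) + (σ p)⁻¹ * ρ) := by
    rw [hρ]
    field_simp
    ring
  have e2 : q - p = A + σ p * d + ρ := by rw [hρ]; ring
  have i1 := h.lamperti_taylor p q
  have i2 : (q - p) ^ 2 ≤ 3 * (A ^ 2 + M ^ 2 * d ^ 2 + ρ ^ 2) := by
    rw [e2]
    refine (add_add_sq_le _ _ _).trans ?_
    have : (σ p * d) ^ 2 ≤ M ^ 2 * d ^ 2 := by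
      rw [mul_pow]
      exact mul_le_mul_of_nonneg_right (sq_le_sq' (abs_le.1 (h.le p)).1 (abs_le.1 (h.le p)).2)
        (sq_nonneg d)
    linarith
  have i3 : |(σ p)⁻¹ * ρ| ≤ M * |ρ| := by
    rw [abs_mul]
    exact mul_le_mul_of_nonneg_right (h.inv_le p) (abs_nonneg _)
  have i4 : M ^ 3 * (q - p) ^ 2 ≤ M ^ 3 * (3 * (A ^ 2 + M ^ 2 * d ^ 2 + ρ ^ 2)) :=
    mul_le_mul_of_nonneg_left i2 (pow_nonneg hM 3)
  rw [e]
  refine (abs_add_le _ _).trans ?_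
  have i5 := abs_add_le (-(A' - (σ p)⁻¹ * A)) ((σ p)⁻¹ * ρ)
  rw [abs_neg] at i5
  linarith

end CoefficientBounds

/-! ### Hölder paths and the chain rule for solutions. -/

/-- Hölder continuity on the unit interval. -/
def UnitHolder (K β : ℝ) (b : ℝ → ℝ) : Prop :=
  ∀ s ∈ Icc (0 : ℝ) 1, ∀ t ∈ Icc (0 : ℝ) 1, |b t - b s| ≤ K * |t - s| ^ β

theorem intervalIntegrable_of_continuousOn_unit {f : ℝ → ℝ} (hf : ContinuousOn f (Icc 0 1))
    {s t : ℝ} (hs : s ∈ Icc (0 : ℝ) 1) (ht : t ∈ Icc (0 : ℝ) 1) :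
    IntervalIntegrable f volume s t :=
  (hf.mono (uIcc_subset_Icc hs ht)).intervalIntegrable

theorem abs_integral_le_mul {f : ℝ → ℝ} {C s t : ℝ} (hst : s ≤ t)
    (h : ∀ r ∈ Icc s t, |f r| ≤ C) : |∫ r in s..t, f r| ≤ C * (t - s) := by
  rw [← abs_of_nonneg (sub_nonneg.2 hst), ← Real.norm_eq_abs]
  refine intervalIntegral.norm_integral_le_of_norm_le_const fun r hr => ?_
  rw [uIoc_of_le hst] at hr
  exact h r (Ioc_subset_Icc_self hr)

/-- Squared increments of a `β`-Hölder path over mesh `k` are thus `k` times a factor that tends to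
`0` with `k`, so their sum over a partition vanishes in the limit. -/
theorem rpow_sq_eq {k β : ℝ} (hk : 0 ≤ k) (hβ : 1 / 2 < β) :
    (k ^ β) ^ 2 = k ^ (2 * β - 1) * k := by
  rcases hk.eq_or_lt with rfl | h0
  · rw [mul_zero, Real.zero_rpow (by linarith)]
    simp
  · rw [← Real.rpow_natCast, ← Real.rpow_mul h0.le, ← Real.rpow_add_one h0.ne']
    congr 1
    push_cast
    ring

/-- The chain rule for the Lamperti transform of a solution: in the Lamperti coordinate the noise is
additive. -/
theorem IsPathwiseSolution.lamperti_eq {a σ b x : ℝ → ℝ} {M K β x₀ : ℝ}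
    (h : CoefficientBounds a σ M) (hx : IsPathwiseSolution a σ x₀ b x) (hb : UnitHolder K β b)
    (hβ : 1 / 2 < β) {t : ℝ} (ht : t ∈ Icc (0 : ℝ) 1) :
    lamperti σ (x t) - lamperti σ x₀
      = (∫ s in (0 : ℝ)..t, a (x s) * (σ (x s))⁻¹) + (b t - b 0) := by
  obtain ⟨hxc, hx⟩ := hx
  have hM := h.nonneg
  -- The equation itself identifies the indefinite Stieltjes integral, which is what Saks-Henstock
  -- requires.
  set J : ℝ → ℝ := fun r => x r - x₀ - ∫ s in (0 : ℝ)..r, a (x s) with hJ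
  have hI : ∀ r ∈ Icc (0 : ℝ) 1, HasRSIntegral (fun s => σ (x s)) b 0 r (J r) := by
    intro r hr
    obtain ⟨I, h1, h2⟩ := hx r hr
    rwa [show J r = I by simp only [hJ]; linarith]
  have h01 : (0 : ℝ) ∈ Icc (0 : ℝ) 1 := by simp
  have hx0 : x 0 = x₀ := by
    obtain ⟨I, h1, h2⟩ := hx 0 h01
    rw [h2, h1.eq_zero]
    simp
  have hac : ContinuousOn (fun s => a (x s)) (Icc 0 1) := h.drift_continuous.comp_continuousOn hxc
  have hic : ContinuousOn (fun s => (σ (x s))⁻¹) (Icc 0 1) := h.continuous_inv.comp_continuousOn hxc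
  have hαc : ContinuousOn (fun s => a (x s) * (σ (x s))⁻¹) (Icc 0 1) := hac.mul hic
  rw [← sub_eq_zero]
  -- `M ^ 4` comes from freezing `1/σ` in the drift, `M` from the local errors `ρ`, and the last
  -- term from the quadratic Taylor remainder, split into drift, noise and `ρ`.
  refine eq_zero_of_forall_abs_le_mul
    (C := M ^ 4 + M + 3 * M ^ 3 * (M ^ 2 + M ^ 2 + 1)) fun ε hε hε1 => ?_
  obtain ⟨δ₁, hδ₁, hSH⟩ := HasRSIntegral.saks_henstock
    (fun r hr => hI r (Icc_subset_Icc_right ht.2 hr)) hε ht.1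
  obtain ⟨δ₂, hδ₂, huc⟩ := Metric.uniformContinuousOn_iff.1
    (isCompact_Icc.uniformContinuousOn_of_continuous hxc) ε hε
  have hlim : Filter.Tendsto (fun m : ℕ => t / m) Filter.atTop (nhds 0) :=
    tendsto_const_div_atTop_nhds_zero_nat t
  have hlim2 : Filter.Tendsto (fun m : ℕ => K ^ 2 * t * (t / m) ^ (2 * β - 1)) Filter.atTop
      (nhds 0) := by
    have := (hlim.rpow_const (p := 2 * β - 1) (Or.inr (by linarith))).const_mul (K ^ 2 * t)
    rwa [Real.zero_rpow (by linarith), mul_zero] at this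
  obtain ⟨m, hm1, hm2, hm3, hm4, hm5⟩ := ((hlim.eventually_lt_const hδ₁).and
    ((hlim.eventually_lt_const hδ₂).and ((hlim.eventually_lt_const hε).and
    ((hlim2.eventually_lt_const hε).and (Filter.eventually_gt_atTop 0))))).exists
  have hm0 : (0 : ℝ) < m := by exact_mod_cast hm5
  set k : ℝ := t / m with hk
  have hmk : m * k = t := mul_div_cancel₀ _ hm0.ne'
  have hk0 : 0 ≤ k := div_nonneg ht.1 hm0.le
  set u : ℕ → ℝ := fun i => i * k with hu
  have hu0 : u 0 = 0 := by simp [hu]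
  have hum : u m = t := hmk
  have hustep : ∀ i, u (i + 1) - u i = k := fun i => by simp only [hu]; push_cast; ring
  have humono : Monotone u := monotone_nat_of_le_succ fun i => by linarith [hustep i]
  have humem : ∀ i ≤ m, u i ∈ Icc (0 : ℝ) 1 := fun i hi =>
    ⟨hu0 ▸ humono (Nat.zero_le i), ((humono hi).trans hum.le).trans ht.2⟩
  have hsum := hSH m u humono hu0 hum fun i _ => by rw [hustep i]; exact hm1
  set ρ : ℕ → ℝ := fun i =>
    J (u (i + 1)) - J (u i) - σ (x (u i)) * (b (u (i + 1)) - b (u i)) with hρ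
  have hstep : ∀ i ∈ Finset.range m,
      |lamperti σ (x (u (i + 1))) - lamperti σ (x (u i))
        - (∫ s in (u i)..(u (i + 1)), a (x s) * (σ (x s))⁻¹) - (b (u (i + 1)) - b (u i))|
      ≤ M ^ 4 * ε * k + M * |ρ i| + 3 * M ^ 3 *
        (M ^ 2 * k ^ 2 + M ^ 2 * (K ^ 2 * (k ^ (2 * β - 1) * k)) + |ρ i|) := by
    intro i hi
    have hi' := Finset.mem_range.1 hi
    have m1 := humem i hi'.le
    have m2 := humem (i + 1) hi'
    have hle : u i ≤ u (i + 1) := humono (Nat.le_succ i)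
    have hab : |u (i + 1) - u i| = k := by rw [hustep, abs_of_nonneg hk0]
    have hii := intervalIntegrable_of_continuousOn_unit hac m1 m2
    have hρ' : ρ i = x (u (i + 1)) - x (u i) - (∫ s in (u i)..(u (i + 1)), a (x s))
        - σ (x (u i)) * (b (u (i + 1)) - b (u i)) := by
      rw [← intervalIntegral.integral_interval_sub_left
        (intervalIntegrable_of_continuousOn_unit hac h01 m2)
        (intervalIntegrable_of_continuousOn_unit hac h01 m1)]
      simp only [hρ, hJ]
      ring
    have i0 := h.lamperti_increment (x (u i)) (x (u (i + 1)))
      (∫ s in (u i)..(u (i + 1)), a (x s)) (∫ s in (u i)..(u (i + 1)), a (x s) * (σ (x s))⁻¹)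
      (b (u (i + 1)) - b (u i))
    rw [← hρ'] at i0
    have i1 : |(∫ s in (u i)..(u (i + 1)), a (x s) * (σ (x s))⁻¹)
        - (σ (x (u i)))⁻¹ * ∫ s in (u i)..(u (i + 1)), a (x s)| ≤ M ^ 4 * ε * k := by
      rw [← intervalIntegral.integral_const_mul, ← intervalIntegral.integral_sub
        (intervalIntegrable_of_continuousOn_unit hαc m1 m2) (hii.const_mul _), ← hustep i]
      refine abs_integral_le_mul hle fun s hs => ?_
      have hs1 : s ∈ Icc (0 : ℝ) 1 := ⟨m1.1.trans hs.1, hs.2.trans m2.2⟩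
      have hd : |x s - x (u i)| ≤ ε := by
        refine (huc s hs1 (u i) m1 ?_).le
        rw [Real.dist_eq, abs_of_nonneg (by linarith [hs.1])]
        linarith [hs.2, hustep i]
      rw [show a (x s) * (σ (x s))⁻¹ - (σ (x (u i)))⁻¹ * a (x s)
        = a (x s) * ((σ (x s))⁻¹ - (σ (x (u i)))⁻¹) by ring, abs_mul]
      calc _ ≤ M * (M ^ 3 * ε) := mul_le_mul (h.drift_le _)
            ((h.inv_lip _ _).trans (mul_le_mul_of_nonneg_left hd (by positivity)))
            (abs_nonneg _) hM
        _ = _ := by ring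
    have i2 : (∫ s in (u i)..(u (i + 1)), a (x s)) ^ 2 ≤ M ^ 2 * k ^ 2 := by
      rw [← mul_pow, ← sq_abs]
      refine pow_le_pow_left₀ (abs_nonneg _) ?_ 2
      rw [← hustep i]
      exact abs_integral_le_mul hle fun s _ => h.drift_le _
    have i3 : (b (u (i + 1)) - b (u i)) ^ 2 ≤ K ^ 2 * (k ^ (2 * β - 1) * k) := by
      have := pow_le_pow_left₀ (abs_nonneg _) (hb _ m1 _ m2) 2
      rw [sq_abs, hab, mul_pow] at this
      rwa [rpow_sq_eq hk0 hβ] at this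
    -- The sum of all `|ρ i|` is at most `ε ≤ 1`, so the quadratic contribution of `ρ` is dominated
    -- by the linear one.
    have i4 : ρ i ^ 2 ≤ |ρ i| := by
      have : |ρ i| ≤ 1 := ((Finset.single_le_sum (f := fun i => |ρ i|)
        (fun j _ => abs_nonneg _) hi).trans hsum).trans hε1
      rw [← sq_abs]
      nlinarith [abs_nonneg (ρ i)]
    refine i0.trans ?_
    gcongr
  have htel : (lamperti σ (x t) - lamperti σ x₀) - ((∫ s in (0 : ℝ)..t, a (x s) * (σ (x s))⁻¹)
      + (b t - b 0)) = ∑ i ∈ Finset.range m, (lamperti σ (x (u (i + 1))) - lamperti σ (x (u i))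
        - (∫ s in (u i)..(u (i + 1)), a (x s) * (σ (x s))⁻¹) - (b (u (i + 1)) - b (u i))) := by
    rw [Finset.sum_sub_distrib, Finset.sum_sub_distrib,
      Finset.sum_range_sub (fun i => lamperti σ (x (u i))), Finset.sum_range_sub (fun i => b (u i)),
      intervalIntegral.sum_integral_adjacent_intervals fun i hi =>
        intervalIntegrable_of_continuousOn_unit hαc (humem i hi.le) (humem (i + 1) hi), hu0, hum,
      hx0]
    ring
  rw [htel]
  refine (Finset.abs_sum_le_sum_abs _ _).trans ((Finset.sum_le_sum hstep).trans ?_)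
  have e : ∑ i ∈ Finset.range m, (M ^ 4 * ε * k + M * |ρ i| + 3 * M ^ 3 *
        (M ^ 2 * k ^ 2 + M ^ 2 * (K ^ 2 * (k ^ (2 * β - 1) * k)) + |ρ i|))
      = M ^ 4 * ε * (m * k) + M * ∑ i ∈ Finset.range m, |ρ i| + 3 * M ^ 3 *
        (M ^ 2 * ((m * k) * k) + M ^ 2 * (K ^ 2 * (m * k) * k ^ (2 * β - 1))
          + ∑ i ∈ Finset.range m, |ρ i|) := by
    simp only [Finset.sum_add_distrib, Finset.mul_sum, Finset.sum_const, Finset.card_range,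
      nsmul_eq_mul, mul_add]
    ring
  rw [e, hmk]
  have j1 : t * k ≤ ε := by nlinarith [ht.1, ht.2]
  calc _ ≤ M ^ 4 * ε * 1 + M * ε + 3 * M ^ 3 * (M ^ 2 * ε + M ^ 2 * ε + ε) := by
        gcongr
        exact ht.2
    _ = _ := by ring

theorem abs_sub_le_of_mem_uIcc {p q r z B : ℝ} (hz : z ∈ uIcc p q) (hp : |r - p| ≤ B)
    (hq : |r - q| ≤ B) : |r - z| ≤ B := by
  rw [abs_le] at *
  rcases mem_uIcc.1 hz with h | h <;> constructor <;> linarith [h.1, h.2, hp.1, hp.2, hq.1, hq.2]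

/-- Jensen's inequality on an interval of length one, by nonnegativity of the variance. -/
theorem sq_integral_unit_le {f : ℝ → ℝ} (hf : ContinuousOn f (Icc 0 1)) :
    (∫ t in (0 : ℝ)..1, f t) ^ 2 ≤ ∫ t in (0 : ℝ)..1, f t ^ 2 := by
  have h0 : (0 : ℝ) ∈ Icc (0 : ℝ) 1 := by simp
  have h1 : (1 : ℝ) ∈ Icc (0 : ℝ) 1 := by simp
  set m := ∫ t in (0 : ℝ)..1, f t with hm
  have i1 := intervalIntegrable_of_continuousOn_unit hf h0 h1
  have i2 : IntervalIntegrable (fun t => f t ^ 2) volume 0 1 :=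
    intervalIntegrable_of_continuousOn_unit (hf.pow 2) h0 h1
  have e : ∫ t in (0 : ℝ)..1, (f t - m) ^ 2 = (∫ t in (0 : ℝ)..1, f t ^ 2) - m ^ 2 := by
    have : ∀ t, (f t - m) ^ 2 = f t ^ 2 - 2 * m * f t + m ^ 2 := fun t => by ring
    simp_rw [this]
    rw [intervalIntegral.integral_add (i2.sub (i1.const_mul _)) (by simp),
      intervalIntegral.integral_sub i2 (i1.const_mul _), intervalIntegral.integral_const_mul, ← hm]
    simp
    ring
  have : 0 ≤ ∫ t in (0 : ℝ)..1, (f t - m) ^ 2 :=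
    intervalIntegral.integral_nonneg zero_le_one fun t _ => sq_nonneg _
  linarith

theorem HasRSIntegral.rsIntegral_eq {f g : ℝ → ℝ} {s t I : ℝ} (hst : s ≤ t)
    (h : HasRSIntegral f g s t I) : rsIntegral f g s t = I := by
  have hex : ∃ I, HasRSIntegral f g s t I := ⟨I, h⟩
  rw [rsIntegral, dif_pos hex]
  exact hex.choose_spec.unique hst h

/-! ### Regularity of solutions, the integral of `σ'(x)`, and the weight. -/

/-- `x` is a continuous path whose Lamperti transform solves the equation with drift `a / σ` and
additive noise `b`. -/
structure IsLampertiSolution (a σ b x : ℝ → ℝ) (x₀ : ℝ) : Prop where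
  continuousOn : ContinuousOn x (Icc 0 1)
  eq : ∀ t ∈ Icc (0 : ℝ) 1, lamperti σ (x t) - lamperti σ x₀
    = (∫ s in (0 : ℝ)..t, a (x s) * (σ (x s))⁻¹) + (b t - b 0)

namespace IsLampertiSolution

variable {a σ b x : ℝ → ℝ} {M K β x₀ : ℝ}

theorem continuousOn_drift (hx : IsLampertiSolution a σ b x x₀) (h : CoefficientBounds a σ M) :
    ContinuousOn (fun s => a (x s) * (σ (x s))⁻¹) (Icc 0 1) :=
  (h.drift_continuous.comp_continuousOn hx.continuousOn).mul
    (h.continuous_inv.comp_continuousOn hx.continuousOn)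

theorem sub_eq (hx : IsLampertiSolution a σ b x x₀) (h : CoefficientBounds a σ M) {s t : ℝ}
    (hs : s ∈ Icc (0 : ℝ) 1) (ht : t ∈ Icc (0 : ℝ) 1) :
    lamperti σ (x t) - lamperti σ (x s) = (∫ r in s..t, a (x r) * (σ (x r))⁻¹) + (b t - b s) := by
  have h01 : (0 : ℝ) ∈ Icc (0 : ℝ) 1 := by simp
  have hc := hx.continuousOn_drift h
  rw [← intervalIntegral.integral_interval_sub_left
    (intervalIntegrable_of_continuousOn_unit hc h01 ht)
    (intervalIntegrable_of_continuousOn_unit hc h01 hs)]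
  linarith [hx.eq s hs, hx.eq t ht]

theorem abs_drift_le (h : CoefficientBounds a σ M) (x : ℝ) : |a x * (σ x)⁻¹| ≤ M * M := by
  rw [abs_mul]
  exact mul_le_mul (h.drift_le x) (h.inv_le x) (abs_nonneg _) h.nonneg

/-- With additive noise the transformed path is a Lipschitz drift term plus `b`, and the inverse
transform is `M`-Lipschitz, so `x` inherits the exponent of the noise. -/
theorem unitHolder (hx : IsLampertiSolution a σ b x x₀) (h : CoefficientBounds a σ M)
    (hb : UnitHolder K β b) (hβ1 : β ≤ 1) : UnitHolder (M * (M * M + K)) β x := by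
  have key : ∀ s ∈ Icc (0 : ℝ) 1, ∀ t ∈ Icc (0 : ℝ) 1, s ≤ t →
      |x t - x s| ≤ M * (M * M + K) * |t - s| ^ β := by
    intro s hs t ht hst
    have h1 := h.abs_sub_le_lamperti (x t) (x s)
    rw [hx.sub_eq h hs ht] at h1
    have h2 : |∫ r in s..t, a (x r) * (σ (x r))⁻¹| ≤ M * M * (t - s) :=
      abs_integral_le_mul hst fun r _ => abs_drift_le h _
    have h3 := hb s hs t ht
    have h4 : t - s ≤ |t - s| ^ β := by
      rw [abs_of_nonneg (sub_nonneg.2 hst)]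
      exact Real.self_le_rpow_of_le_one (sub_nonneg.2 hst) (by linarith [hs.1, ht.2]) hβ1
    have hM := h.nonneg
    calc |x t - x s| ≤ M * (M * M * (t - s) + K * |t - s| ^ β) :=
          h1.trans (mul_le_mul_of_nonneg_left ((abs_add_le _ _).trans (add_le_add h2 h3)) hM)
      _ ≤ M * (M * M * |t - s| ^ β + K * |t - s| ^ β) := by gcongr
      _ = _ := by ring
  intro s hs t ht
  rcases le_total s t with hst | hst
  · exact key s hs t ht hst
  · rw [abs_sub_comm, abs_sub_comm t]
    exact key t ht s hs hst

/-- The value is dictated by the formal rule d log σ(x) = σ'(x) (a/σ)(x) dt + σ'(x) db. On an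
interval of length `k` the two sides differ by O(k^{2β}) whatever the tag, because `σ'(x)`
oscillates by O(k^β) and `b` moves by O(k^β). The total is O(δ^{2β-1}), and no general theory of
Young integration is needed. -/
theorem hasRSIntegral (hx : IsLampertiSolution a σ b x x₀) (h : CoefficientBounds a σ M)
    (hb : UnitHolder K β b) (hβ : 1 / 2 < β) (hβ1 : β ≤ 1) {t : ℝ} (ht : t ∈ Icc (0 : ℝ) 1) :
    HasRSIntegral (fun s => deriv σ (x s)) b t 1 (Real.log (σ (x 1)) - Real.log (σ (x t))
      - ∫ s in t..1, deriv σ (x s) * (a (x s) * (σ (x s))⁻¹)) := by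
  intro ε hε
  have hM := h.nonneg
  have hK : 0 ≤ K := by
    have := hb 0 (by simp) 1 (by simp)
    norm_num at this
    exact (abs_nonneg _).trans this
  set L := M * (M * M + K) with hL
  have hL0 : 0 ≤ L := by positivity
  have hxH := hx.unitHolder h hb hβ1
  set C := M * L * (K + M * M) with hC
  have hC0 : 0 ≤ C := by positivity
  have hlim : Filter.Tendsto (fun δ : ℝ => C * δ ^ (2 * β - 1)) (nhdsWithin 0 (Ioi 0)) (nhds 0) := by
    have : Filter.Tendsto (fun δ : ℝ => C * δ ^ (2 * β - 1)) (nhds 0) (nhds 0) := by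
      have := ((Real.continuous_rpow_const (q := 2 * β - 1) (by linarith)).tendsto 0).const_mul C
      rwa [Real.zero_rpow (by linarith), mul_zero] at this
    exact this.mono_left nhdsWithin_le_nhds
  obtain ⟨δ, hδε, hδ⟩ := ((hlim.eventually_lt_const hε).and self_mem_nhdsWithin).exists
  have hδ : 0 < δ := hδ
  refine ⟨δ, hδ, fun m u ξ hu0 hum hu => ?_⟩
  have hmono : ∀ i ≤ m, u 0 ≤ u i := by
    intro i
    induction i with
    | zero => simp
    | succ i ih => exact fun hi => (ih (by omega)).trans ((hu i hi).1.trans (hu i hi).2.1)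
  have hmono' : ∀ i ≤ m, u (m - i) ≤ u m := by
    intro i
    induction i with
    | zero => simp
    | succ i ih =>
      intro hi
      have := hu (m - (i + 1)) (by omega)
      rw [show m - (i + 1) + 1 = m - i by omega] at this
      exact (this.1.trans this.2.1).trans (ih (by omega))
  have humem : ∀ i ≤ m, u i ∈ Icc (0 : ℝ) 1 := fun i hi => ⟨ht.1.trans (hu0 ▸ hmono i hi), by
    have := hmono' (m - i) (by omega)
    rwa [Nat.sub_sub_self hi, hum] at this⟩
  have hσc : ContinuousOn (fun s => deriv σ (x s)) (Icc 0 1) :=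
    h.deriv_continuous.comp_continuousOn hx.continuousOn
  have hαc := hx.continuousOn_drift h
  have hpc : ContinuousOn (fun s => deriv σ (x s) * (a (x s) * (σ (x s))⁻¹)) (Icc 0 1) :=
    hσc.mul hαc
  have htel : Real.log (σ (x 1)) - Real.log (σ (x t))
      - (∫ s in t..1, deriv σ (x s) * (a (x s) * (σ (x s))⁻¹))
      = ∑ i ∈ Finset.range m, (Real.log (σ (x (u (i + 1)))) - Real.log (σ (x (u i)))
        - ∫ s in (u i)..(u (i + 1)), deriv σ (x s) * (a (x s) * (σ (x s))⁻¹)) := by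
    rw [Finset.sum_sub_distrib, Finset.sum_range_sub (fun i => Real.log (σ (x (u i)))),
      intervalIntegral.sum_integral_adjacent_intervals fun i hi =>
        intervalIntegrable_of_continuousOn_unit hpc (humem i hi.le) (humem (i + 1) hi), hu0, hum]
  have hstep : ∀ i ∈ Finset.range m, |deriv σ (x (ξ i)) * (b (u (i + 1)) - b (u i))
      - (Real.log (σ (x (u (i + 1)))) - Real.log (σ (x (u i)))
        - ∫ s in (u i)..(u (i + 1)), deriv σ (x s) * (a (x s) * (σ (x s))⁻¹))|
      ≤ C * δ ^ (2 * β - 1) * (u (i + 1) - u i) := by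
    intro i hi
    have hi' := Finset.mem_range.1 hi
    obtain ⟨hu1, hu2, hu3⟩ := hu i hi'
    have m1 := humem i hi'.le
    have m2 := humem (i + 1) hi'
    have hle := hu1.trans hu2
    set k := u (i + 1) - u i with hk
    have hk0 : 0 ≤ k := sub_nonneg.2 hle
    have hk1 : k ≤ 1 := by linarith [m1.1, m2.2]
    -- Here `z` is a state between the two endpoint values of `x`, not a time, so closeness of `x r`
    -- to `z` follows from closeness to both endpoint values.
    obtain ⟨z, hz, hlog⟩ := exists_sub_eq_mul_sub h.inv_pos h.lamperti_hasDerivAt h.log_hasDerivAt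
      (x (u i)) (x (u (i + 1)))
    have hosc : ∀ r ∈ Icc (u i) (u (i + 1)), |deriv σ (x r) - deriv σ z| ≤ M * (L * k ^ β) := by
      intro r hr
      have hr' : r ∈ Icc (0 : ℝ) 1 := ⟨m1.1.trans hr.1, hr.2.trans m2.2⟩
      refine (h.deriv_lip _ _).trans (mul_le_mul_of_nonneg_left (abs_sub_le_of_mem_uIcc hz
        ((hxH _ m1 _ hr').trans ?_) ((hxH _ m2 _ hr').trans ?_)) hM) <;>
      · refine mul_le_mul_of_nonneg_left (Real.rpow_le_rpow (abs_nonneg _) ?_ (by linarith)) hL0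
        rw [abs_le]
        constructor <;> linarith [hr.1, hr.2]
    have hbd : |b (u (i + 1)) - b (u i)| ≤ K * k ^ β := by
      have := hb _ m1 _ m2
      rwa [← hk, abs_of_nonneg hk0] at this
    have hint : |(∫ s in (u i)..(u (i + 1)), deriv σ (x s) * (a (x s) * (σ (x s))⁻¹))
        - deriv σ z * ∫ s in (u i)..(u (i + 1)), a (x s) * (σ (x s))⁻¹|
        ≤ M * (L * k ^ β) * (M * M) * k := by
      rw [← intervalIntegral.integral_const_mul, ← intervalIntegral.integral_sub
        (intervalIntegrable_of_continuousOn_unit hpc m1 m2)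
        ((intervalIntegrable_of_continuousOn_unit hαc m1 m2).const_mul _)]
      refine abs_integral_le_mul hle fun r hr => ?_
      rw [← sub_mul, abs_mul]
      exact mul_le_mul (hosc r hr) (abs_drift_le h _) (abs_nonneg _) (by positivity)
    rw [hlog, hx.sub_eq h m1 m2]
    have e : deriv σ (x (ξ i)) * (b (u (i + 1)) - b (u i))
      - (deriv σ z * ((∫ r in (u i)..(u (i + 1)), a (x r) * (σ (x r))⁻¹)
        + (b (u (i + 1)) - b (u i)))
        - ∫ s in (u i)..(u (i + 1)), deriv σ (x s) * (a (x s) * (σ (x s))⁻¹))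
      = (deriv σ (x (ξ i)) - deriv σ z) * (b (u (i + 1)) - b (u i))
        + ((∫ s in (u i)..(u (i + 1)), deriv σ (x s) * (a (x s) * (σ (x s))⁻¹))
        - deriv σ z * ∫ s in (u i)..(u (i + 1)), a (x s) * (σ (x s))⁻¹) := by ring
    rw [e]
    have i1 : |(deriv σ (x (ξ i)) - deriv σ z) * (b (u (i + 1)) - b (u i))|
        ≤ M * (L * k ^ β) * (K * k ^ β) := by
      rw [abs_mul]
      exact mul_le_mul (hosc _ ⟨hu1, hu2⟩) hbd (abs_nonneg _) (by positivity)
    have i2 : k ≤ k ^ β := Real.self_le_rpow_of_le_one hk0 hk1 hβ1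
    calc _ ≤ M * (L * k ^ β) * (K * k ^ β) + M * (L * k ^ β) * (M * M) * k :=
          (abs_add_le _ _).trans (add_le_add i1 hint)
      _ ≤ M * (L * k ^ β) * (K * k ^ β) + M * (L * k ^ β) * (M * M) * k ^ β := by gcongr
      _ = C * (k ^ β) ^ 2 := by rw [hC]; ring
      _ = C * k ^ (2 * β - 1) * k := by rw [rpow_sq_eq hk0 hβ]; ring
      _ ≤ C * δ ^ (2 * β - 1) * k := by
          gcongr
          linarith
  rw [htel, ← Finset.sum_sub_distrib]
  refine lt_of_le_of_lt ((Finset.abs_sum_le_sum_abs _ _).trans (Finset.sum_le_sum hstep)) ?_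
  rw [← Finset.mul_sum, Finset.sum_range_sub, hu0, hum]
  refine lt_of_le_of_lt (mul_le_of_le_one_right (by positivity) ?_) hδε
  linarith [ht.1]

/-- Exponentiating the increment of `log σ(x)` produces σ(x_1)/σ(x_t), and (aσ' - a'σ)/σ is minus
`lampertiSlope`. No stochastic integral remains in the weight. -/
theorem weightFunction_eq (hx : IsLampertiSolution a σ b x x₀) (h : CoefficientBounds a σ M)
    (hb : UnitHolder K β b) (hβ : 1 / 2 < β) (hβ1 : β ≤ 1) {t : ℝ} (ht : t ∈ Icc (0 : ℝ) 1) :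
    weightFunction a σ b x t = -(σ (x 1) * lampertiSlope a σ (x t) *
      Real.exp (∫ s in t..1, lampertiSlope a σ (x s))) := by
  have h1 : (1 : ℝ) ∈ Icc (0 : ℝ) 1 := by simp
  rw [weightFunction, (hx.hasRSIntegral h hb hβ hβ1 ht).rsIntegral_eq ht.2]
  have e : ∫ s in t..1, lampertiSlope a σ (x s) = (∫ s in t..1, deriv a (x s))
      - ∫ s in t..1, deriv σ (x s) * (a (x s) * (σ (x s))⁻¹) := by
    have c1 : ContinuousOn (fun s => deriv a (x s)) (Icc 0 1) :=
      h.drift_deriv_continuous.comp_continuousOn hx.continuousOn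
    have c2 : ContinuousOn (fun s => deriv σ (x s) * (a (x s) * (σ (x s))⁻¹)) (Icc 0 1) :=
      (h.deriv_continuous.comp_continuousOn hx.continuousOn).mul (hx.continuousOn_drift h)
    rw [← intervalIntegral.integral_sub (intervalIntegrable_of_continuousOn_unit c1 ht h1)
      (intervalIntegrable_of_continuousOn_unit c2 ht h1)]
    refine intervalIntegral.integral_congr fun s _ => ?_
    simp only [lampertiSlope]
    ring
  rw [e, show ∀ p q r w : ℝ, p + (q - r - w) = (p - w) + q - r by intros; ring, Real.exp_sub,
    Real.exp_add, Real.exp_log (h.pos _), Real.exp_log (h.pos _), lampertiSlope]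
  have := (h.pos (x t)).ne'
  field_simp
  ring

end IsLampertiSolution

/-! ### Pathwise linearization of the difference of two solutions. -/

/-- The first order approximation of the difference of two solutions driven by noises that differ
by `e`. -/
noncomputable def linearizedError (a σ x e : ℝ → ℝ) : ℝ :=
  ∫ t in (0 : ℝ)..1, σ (x 1) * lampertiSlope a σ (x t) *
    Real.exp (∫ s in t..1, lampertiSlope a σ (x s)) * e t

/-- Gronwall's inequality with the forcing measured in L², as needed for a remainder of size ∫ e².
-/
theorem sq_le_integral_sq_of_abs_deriv_le {v k e : ℝ → ℝ} {Λ : ℝ} (hk : Continuous k)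
    (he : Continuous e) (hv : ∀ t, v t = ∫ s in (0 : ℝ)..t, k s)
    (hk_le : ∀ t ∈ Icc (0 : ℝ) 1, |k t| ≤ Λ * (|v t| + |e t|)) (hΛ : 0 ≤ Λ) {t : ℝ}
    (ht : t ∈ Icc (0 : ℝ) 1) :
    v t ^ 2 ≤ Λ * Real.exp (3 * Λ) * ∫ s in (0 : ℝ)..1, e s ^ 2 := by
  have hvd : ∀ t, HasDerivAt v (k t) t := fun t => by
    rw [show v = fun t => ∫ s in (0 : ℝ)..t, k s from funext hv]
    exact hk.integral_hasStrictDerivAt 0 t |>.hasDerivAt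
  have he2 : Continuous fun s => e s ^ 2 := he.pow 2
  -- The rate `3 * Λ` comes from 2 v v' ≤ 2Λ(v² + |v||e|) ≤ 3Λ v² + Λ e²; with it `G` is
  -- nondecreasing from `G 0 = 0`.
  set G : ℝ → ℝ := fun t => Λ * (∫ s in (0 : ℝ)..t, e s ^ 2) - v t ^ 2 * Real.exp (-(3 * Λ) * t)
    with hG
  have hGd : ∀ t, HasDerivAt G (Λ * e t ^ 2 - (2 * v t * k t * Real.exp (-(3 * Λ) * t)
      + v t ^ 2 * (Real.exp (-(3 * Λ) * t) * (-(3 * Λ))))) t := by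
    intro t
    have h1 : HasDerivAt (fun t => ∫ s in (0 : ℝ)..t, e s ^ 2) (e t ^ 2) t :=
      (he2.integral_hasStrictDerivAt 0 t).hasDerivAt
    have h2 : HasDerivAt (fun t => Real.exp (-(3 * Λ) * t))
        (Real.exp (-(3 * Λ) * t) * (-(3 * Λ))) t := by
      simpa using ((hasDerivAt_id t).const_mul (-(3 * Λ))).exp
    have h3 : HasDerivAt (fun t => v t ^ 2) (2 * v t * k t) t := by
      simpa using (hvd t).fun_pow 2
    exact (h1.const_mul Λ).sub (h3.mul h2)
  have hmono : MonotoneOn G (Icc 0 1) := by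
    refine monotoneOn_of_deriv_nonneg (convex_Icc 0 1)
      (fun t _ => (hGd t).continuousAt.continuousWithinAt)
      (fun t _ => (hGd t).differentiableAt.differentiableWithinAt) fun t ht => ?_
    rw [interior_Icc] at ht
    rw [(hGd t).deriv]
    have hE1 : Real.exp (-(3 * Λ) * t) ≤ 1 := Real.exp_le_one_iff.2 (by nlinarith [ht.1])
    have hE0 := Real.exp_pos (-(3 * Λ) * t)
    set E := Real.exp (-(3 * Λ) * t)
    have h1 : 2 * v t * k t ≤ 3 * Λ * v t ^ 2 + Λ * e t ^ 2 := by
      have i1 : v t * k t ≤ |v t| * (Λ * (|v t| + |e t|)) := by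
        refine (le_abs_self _).trans ?_
        rw [abs_mul]
        exact mul_le_mul_of_nonneg_left (hk_le t (Ioo_subset_Icc_self ht)) (abs_nonneg _)
      have i2 : 2 * (|v t| * |e t|) ≤ v t ^ 2 + e t ^ 2 := by
        rw [← sq_abs (v t), ← sq_abs (e t)]
        nlinarith [sq_nonneg (|v t| - |e t|)]
      have i3 := mul_le_mul_of_nonneg_left i2 hΛ
      have i4 : |v t| * |v t| = v t ^ 2 := by rw [← sq_abs]; ring
      nlinarith
    have h2 : (2 * v t * k t - 3 * Λ * v t ^ 2) * E ≤ Λ * e t ^ 2 * E :=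
      mul_le_mul_of_nonneg_right (by linarith) hE0.le
    have h3 : Λ * e t ^ 2 * E ≤ Λ * e t ^ 2 := mul_le_of_le_one_right (by positivity) hE1
    linarith
  have h0 : G 0 ≤ G t := hmono (by simp) ht ht.1
  have hv0 : v 0 = 0 := by simp [hv]
  simp only [hG, hv0, intervalIntegral.integral_same] at h0
  have hint : ∫ s in (0 : ℝ)..t, e s ^ 2 ≤ ∫ s in (0 : ℝ)..1, e s ^ 2 :=
    intervalIntegral.integral_mono_interval le_rfl ht.1 ht.2
      (Filter.Eventually.of_forall fun s => sq_nonneg _) (he2.intervalIntegrable _ _)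
  have hE : v t ^ 2 = v t ^ 2 * Real.exp (-(3 * Λ) * t) * Real.exp (3 * Λ * t) := by
    rw [mul_assoc, ← Real.exp_add]
    simp
  have hQ : 0 ≤ ∫ s in (0 : ℝ)..1, e s ^ 2 :=
    intervalIntegral.integral_nonneg zero_le_one fun t _ => sq_nonneg _
  rw [hE]
  calc _ ≤ (Λ * ∫ s in (0 : ℝ)..1, e s ^ 2) * Real.exp (3 * Λ) := by
        have := mul_le_mul_of_nonneg_left hint hΛ
        exact mul_le_mul (by linarith) (Real.exp_le_exp.2 (by nlinarith [ht.2]))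
          (Real.exp_pos _).le (by positivity)
    _ = _ := by ring

theorem abs_mul_exp_integral_le {f e : ℝ → ℝ} {Γ t : ℝ} (hf : ∀ s, |f s| ≤ Γ)
    (ht : t ∈ Icc (0 : ℝ) 1) : |Real.exp (∫ s in t..1, f s) * e t| ≤ Real.exp Γ * |e t| := by
  rw [abs_mul, abs_of_pos (Real.exp_pos _)]
  refine mul_le_mul_of_nonneg_right (Real.exp_le_exp.2 ?_) (abs_nonneg _)
  have := abs_integral_le_mul ht.2 fun s (_ : s ∈ Icc t 1) => hf s
  have hΓ : 0 ≤ Γ := (abs_nonneg _).trans (hf 0)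
  exact (le_abs_self _).trans (this.trans (mul_le_of_le_one_right hΓ (by linarith [ht.1])))

namespace CoefficientBounds

variable {a σ : ℝ → ℝ} {M : ℝ}

/-- Subtracting the rough term `e` from the difference of the transformed paths leaves a
differentiable `v` solving a linear equation up to a quadratic error. Gronwall bounds `v`, and
variation of constants identifies its leading term. -/
theorem exists_error_bound_of_continuous (h : CoefficientBounds a σ M) : ∃ C, 0 ≤ C ∧
    ∀ x y e : ℝ → ℝ, Continuous x → Continuous y → Continuous e →
      (∀ t ∈ Icc (0 : ℝ) 1, lamperti σ (x t) - lamperti σ (y t)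
        = (∫ s in (0 : ℝ)..t, (a (x s) * (σ (x s))⁻¹ - a (y s) * (σ (y s))⁻¹)) + e t) →
      e 1 = 0 →
      (x 1 - y 1) ^ 2 ≤ C * (∫ t in (0 : ℝ)..1, e t ^ 2) ∧
      linearizedError a σ x e ^ 2 ≤ C * (∫ t in (0 : ℝ)..1, e t ^ 2) ∧
      |x 1 - y 1 - linearizedError a σ x e| ≤ C * ∫ t in (0 : ℝ)..1, e t ^ 2 := by
  have hM := h.nonneg
  obtain ⟨L, hL0, hL⟩ := h.slope_lip
  obtain ⟨Λ, hΛ⟩ : ∃ Λ, Λ = M + M * M * M := ⟨_, rfl⟩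
  have hΛ0 : 0 ≤ Λ := by rw [hΛ]; positivity
  have hΓ : ∀ z, |lampertiSlope a σ z| ≤ Λ := fun z => hΛ ▸ h.slope_le z
  obtain ⟨A, hA⟩ : ∃ A, A = Λ * Real.exp (3 * Λ) := ⟨_, rfl⟩
  have hA0 : 0 ≤ A := by rw [hA]; positivity
  -- The first summand is the Taylor remainder of the inverse Lamperti transform at time `1`; the
  -- second is `M` times the variation-of-constants remainder.
  obtain ⟨C₃, hC₃⟩ : ∃ C₃, C₃ = M * M * A
    + M * (Real.exp Λ * (L * M) * (2 * A + 2)) := ⟨_, rfl⟩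
  have hC₃0 : 0 ≤ C₃ := by rw [hC₃]; positivity
  refine ⟨M ^ 2 * A + (M * Λ * Real.exp Λ) ^ 2 + C₃, by positivity,
    fun x y e hx hy he heq he1 => ?_⟩
  set α : ℝ → ℝ := fun z => a z * (σ z)⁻¹ with hα
  have hαc : Continuous α := h.drift_continuous.mul h.continuous_inv
  set γ : ℝ → ℝ := fun t => lampertiSlope a σ (x t) with hγ
  have hγc : Continuous γ := h.slope_continuous.comp hx
  set k : ℝ → ℝ := fun s => α (x s) - α (y s) with hk
  have hkc : Continuous k := (hαc.comp hx).sub (hαc.comp hy)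
  set v : ℝ → ℝ := fun t => ∫ s in (0 : ℝ)..t, k s with hv
  have hD : ∀ t ∈ Icc (0 : ℝ) 1, lamperti σ (x t) - lamperti σ (y t) = v t + e t := heq
  set Q := ∫ t in (0 : ℝ)..1, e t ^ 2 with hQ
  have hQ0 : 0 ≤ Q := intervalIntegral.integral_nonneg zero_le_one fun t _ => sq_nonneg _
  have hvd : ∀ t, HasDerivAt v (k t) t := fun t => (hkc.integral_hasStrictDerivAt 0 t).hasDerivAt
  have hvc : Continuous v := continuous_iff_continuousAt.2 fun t => (hvd t).continuousAt
  have hv2 : ∀ t ∈ Icc (0 : ℝ) 1, v t ^ 2 ≤ A * Q := by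
    intro t ht
    rw [hA]
    refine sq_le_integral_sq_of_abs_deriv_le hkc he (fun _ => rfl) (fun t ht => ?_) hΛ0 ht
    obtain ⟨z, -, hz⟩ := exists_sub_eq_mul_sub h.inv_pos h.lamperti_hasDerivAt
      h.drift_div_hasDerivAt (y t) (x t)
    rw [hD t ht] at hz
    simp only [hk, hα]
    rw [hz, abs_mul]
    exact mul_le_mul (hΓ z) (abs_add_le _ _) (abs_nonneg _) hΛ0
  have hkD : ∀ t ∈ Icc (0 : ℝ) 1,
      |k t - γ t * (v t + e t)| ≤ L * M * (2 * (A * Q) + 2 * e t ^ 2) := by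
    intro t ht
    have h1 := h.taylor h.drift_div_hasDerivAt hL0 hL (x t) (y t)
    have e1 : α (y t) - α (x t) - lampertiSlope a σ (x t) * (lamperti σ (y t) - lamperti σ (x t))
        = -(k t - γ t * (v t + e t)) := by
      rw [← hD t ht]
      ring
    have e2 : (lamperti σ (y t) - lamperti σ (x t)) ^ 2 = (v t + e t) ^ 2 := by
      rw [← hD t ht]
      ring
    rw [e2] at h1
    have h1' : |α (y t) - α (x t) - lampertiSlope a σ (x t)
      * (lamperti σ (y t) - lamperti σ (x t))| ≤ L * M * (v t + e t) ^ 2 := h1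
    rw [e1, abs_neg] at h1'
    refine h1'.trans (mul_le_mul_of_nonneg_left ?_ (by positivity))
    nlinarith [hv2 t ht, sq_nonneg (v t - e t)]
  set E : ℝ → ℝ := fun t => Real.exp (∫ s in t..1, γ s) with hE
  have hEd : ∀ t, HasDerivAt E (E t * (-γ t)) t := by
    intro t
    have : HasDerivAt (fun t => ∫ s in t..1, γ s) (-γ t) t :=
      intervalIntegral.integral_hasDerivAt_left (hγc.intervalIntegrable _ _)
        (hγc.stronglyMeasurableAtFilter _ _) hγc.continuousAt
    exact this.exp
  have hEc : Continuous E := continuous_iff_continuousAt.2 fun t => (hEd t).continuousAt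
  have hpd : ∀ t, HasDerivAt (fun t => v t * E t) (k t * E t + v t * (E t * (-γ t))) t :=
    fun t => (hvd t).mul (hEd t)
  -- Variation of constants: `E` is the integrating factor with `E 1 = 1`, and (vE)' = E(k - γv),
  -- which is Eγe up to the quadratic error bounded in `hkD`.
  have hv1 : v 1 = ∫ t in (0 : ℝ)..1, (k t * E t + v t * (E t * (-γ t))) := by
    rw [intervalIntegral.integral_eq_sub_of_hasDerivAt (fun t _ => hpd t)
      (Continuous.intervalIntegrable (by fun_prop) _ _)]
    simp [hv, hE]
  have hlin : linearizedError a σ x e = σ (x 1) * ∫ t in (0 : ℝ)..1, E t * (γ t * e t) := by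
    rw [linearizedError, ← intervalIntegral.integral_const_mul]
    refine intervalIntegral.integral_congr fun t _ => ?_
    simp only [hE, hγ]
    ring
  have hrem : |v 1 - ∫ t in (0 : ℝ)..1, E t * (γ t * e t)|
      ≤ Real.exp Λ * (L * M) * (2 * A + 2) * Q := by
    rw [hv1, ← intervalIntegral.integral_sub (Continuous.intervalIntegrable (by fun_prop) _ _)
      (Continuous.intervalIntegrable (by fun_prop) _ _)]
    have e1 : Real.exp Λ * (L * M) * (2 * A + 2) * Q
        = ∫ t in (0 : ℝ)..1, Real.exp Λ * (L * M * (2 * (A * Q) + 2 * e t ^ 2)) := by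
      rw [intervalIntegral.integral_const_mul, intervalIntegral.integral_const_mul,
        intervalIntegral.integral_add (by simp) (Continuous.intervalIntegrable (by fun_prop) _ _),
        intervalIntegral.integral_const_mul 2 fun t => e t ^ 2, ← hQ]
      simp
      ring
    rw [e1]
    have hint : IntervalIntegrable (fun t => Real.exp Λ * (L * M * (2 * (A * Q) + 2 * e t ^ 2)))
        volume 0 1 := Continuous.intervalIntegrable (by fun_prop) _ _
    rw [← Real.norm_eq_abs]
    refine intervalIntegral.norm_integral_le_of_norm_le zero_le_one ?_ hint
    refine Filter.Eventually.of_forall fun t ht => ?_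
    have ht := Ioc_subset_Icc_self ht
    rw [Real.norm_eq_abs, show k t * E t + v t * (E t * (-γ t)) - E t * (γ t * e t)
      = E t * (k t - γ t * (v t + e t)) by ring]
    refine (abs_mul_exp_integral_le (e := fun t => k t - γ t * (v t + e t))
      (fun s => hΓ (x s)) ht).trans ?_
    exact mul_le_mul_of_nonneg_left (hkD t ht) (Real.exp_pos _).le
  have h11 : (1 : ℝ) ∈ Icc (0 : ℝ) 1 := by simp
  -- Because `e 1 = 0`, the smooth part `v` carries the whole difference at the final time.
  have hD1 : lamperti σ (x 1) - lamperti σ (y 1) = v 1 := by rw [hD 1 h11, he1, add_zero]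
  have c1 : (x 1 - y 1) ^ 2 ≤ M ^ 2 * A * Q := by
    have := pow_le_pow_left₀ (abs_nonneg _) (h.abs_sub_le_lamperti (x 1) (y 1)) 2
    rw [hD1, mul_pow, sq_abs, sq_abs] at this
    calc _ ≤ M ^ 2 * v 1 ^ 2 := this
      _ ≤ M ^ 2 * (A * Q) := mul_le_mul_of_nonneg_left (hv2 1 h11) (by positivity)
      _ = _ := by ring
  have c2 : linearizedError a σ x e ^ 2 ≤ (M * Λ * Real.exp Λ) ^ 2 * Q := by
    rw [linearizedError]
    refine (sq_integral_unit_le (Continuous.continuousOn ?_)).trans ?_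
    · exact (((continuous_const.mul hγc).mul hEc).mul he)
    rw [hQ, ← intervalIntegral.integral_const_mul]
    refine intervalIntegral.integral_mono_on zero_le_one (Continuous.intervalIntegrable
      ((((continuous_const.mul hγc).mul hEc).mul he).pow 2) _ _)
      (Continuous.intervalIntegrable (by fun_prop) _ _) fun t ht => ?_
    rw [mul_assoc, mul_pow, ← sq_abs (Real.exp _ * _)]
    have i1 : |Real.exp (∫ s in t..1, γ s) * e t| ≤ Real.exp Λ * |e t| :=
      abs_mul_exp_integral_le (fun s => hΓ (x s)) ht
    have i2 : (σ (x 1) * lampertiSlope a σ (x t)) ^ 2 ≤ (M * Λ) ^ 2 := by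
      rw [← sq_abs, abs_mul]
      exact pow_le_pow_left₀ (by positivity)
        (mul_le_mul (h.le _) (hΓ _) (abs_nonneg _) hM) 2
    calc _ ≤ (M * Λ) ^ 2 * (Real.exp Λ * |e t|) ^ 2 :=
          mul_le_mul i2 (pow_le_pow_left₀ (abs_nonneg _) i1 2) (by positivity) (by positivity)
      _ = _ := by rw [mul_pow (Real.exp Λ), sq_abs]; ring
  have c3 : |x 1 - y 1 - linearizedError a σ x e| ≤ C₃ * Q := by
    have h1 := h.taylor (φ := id) (ψ := σ) (L := M)
      (fun x => by simpa [(h.pos x).ne'] using hasDerivAt_id x) hM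
      (abs_sub_le_of_hasDerivAt h.hasDerivAt h.deriv_le) (x 1) (y 1)
    simp only [id] at h1
    have e1 : y 1 - x 1 - σ (x 1) * (lamperti σ (y 1) - lamperti σ (x 1))
        = -(x 1 - y 1 - σ (x 1) * v 1) := by rw [← hD1]; ring
    have e2 : (lamperti σ (y 1) - lamperti σ (x 1)) ^ 2 = v 1 ^ 2 := by rw [← hD1]; ring
    rw [e1, e2, abs_neg] at h1
    have h2 : |σ (x 1) * (v 1 - ∫ t in (0 : ℝ)..1, E t * (γ t * e t))|
        ≤ M * (Real.exp Λ * (L * M) * (2 * A + 2) * Q) := by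
      rw [abs_mul]
      exact mul_le_mul (h.le _) hrem (abs_nonneg _) hM
    have h3 := mul_le_mul_of_nonneg_left (hv2 1 h11) (mul_nonneg hM hM)
    rw [show x 1 - y 1 - linearizedError a σ x e = (x 1 - y 1 - σ (x 1) * v 1)
      + σ (x 1) * (v 1 - ∫ t in (0 : ℝ)..1, E t * (γ t * e t)) by rw [hlin]; ring]
    refine (abs_add_le _ _).trans ?_
    rw [hC₃]
    linarith
  have q1 : 0 ≤ M ^ 2 * A * Q := by positivity
  have q2 : 0 ≤ (M * Λ * Real.exp Λ) ^ 2 * Q := by positivity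
  have q3 : 0 ≤ C₃ * Q := by positivity
  rw [add_mul, add_mul]
  exact ⟨by linarith, by linarith, by linarith⟩

/-- The difference of two solutions with additive noises that differ by `e`, `e 1 = 0`, agrees with
its linearization up to the squared `L²` norm of `e`. -/
theorem exists_error_bound (h : CoefficientBounds a σ M) : ∃ C, 0 ≤ C ∧
    ∀ (b b' x y : ℝ → ℝ) (x₀ : ℝ), IsLampertiSolution a σ b x x₀ →
      IsLampertiSolution a σ b' y x₀ → ContinuousOn (fun t => b t - b' t) (Icc 0 1) →
      b 0 - b' 0 = 0 → b 1 - b' 1 = 0 →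
      (x 1 - y 1) ^ 2 ≤ C * (∫ t in (0 : ℝ)..1, (b t - b' t) ^ 2) ∧
      linearizedError a σ x (fun t => b t - b' t) ^ 2
        ≤ C * (∫ t in (0 : ℝ)..1, (b t - b' t) ^ 2) ∧
      |x 1 - y 1 - linearizedError a σ x (fun t => b t - b' t)|
        ≤ C * ∫ t in (0 : ℝ)..1, (b t - b' t) ^ 2 := by
  obtain ⟨C, hC0, hC⟩ := h.exists_error_bound_of_continuous
  refine ⟨C, hC0, fun b b' x y x₀ hx hy he he0 he1 => ?_⟩
  -- Extending the paths by their endpoint values makes them continuous on the line and leaves every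
  -- integral over `[0, 1]` unchanged.
  have hext : ∀ (f : ℝ → ℝ), ∀ t ∈ Icc (0 : ℝ) 1,
      IccExtend zero_le_one ((Icc (0 : ℝ) 1).domRestrict f) t = f t := fun f t ht => by
    rw [IccExtend_of_mem _ _ ht, domRestrict_apply]
  set x' := IccExtend zero_le_one ((Icc (0 : ℝ) 1).domRestrict x)
  set y' := IccExtend zero_le_one ((Icc (0 : ℝ) 1).domRestrict y)
  set e' := IccExtend zero_le_one ((Icc (0 : ℝ) 1).domRestrict fun t => b t - b' t)
  have hx' : ∀ t ∈ Icc (0 : ℝ) 1, x' t = x t := hext x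
  have hy' : ∀ t ∈ Icc (0 : ℝ) 1, y' t = y t := hext y
  have he' : ∀ t ∈ Icc (0 : ℝ) 1, e' t = b t - b' t := hext _
  have h0 : (0 : ℝ) ∈ Icc (0 : ℝ) 1 := by simp
  have h1 : (1 : ℝ) ∈ Icc (0 : ℝ) 1 := by simp
  have key := hC x' y' e' hx.continuousOn.domRestrict.Icc_extend' hy.continuousOn.domRestrict.Icc_extend'
    he.domRestrict.Icc_extend' ?_ (by rw [he' 1 h1, he1])
  · have e1 : ∫ t in (0 : ℝ)..1, e' t ^ 2 = ∫ t in (0 : ℝ)..1, (b t - b' t) ^ 2 :=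
      intervalIntegral.integral_congr fun t ht => by
        rw [uIcc_of_le zero_le_one] at ht
        simp only [he' t ht]
    have e2 : linearizedError a σ x' e' = linearizedError a σ x (fun t => b t - b' t) := by
      refine intervalIntegral.integral_congr fun t ht => ?_
      rw [uIcc_of_le zero_le_one] at ht
      have e3 : ∫ s in t..1, lampertiSlope a σ (x' s) = ∫ s in t..1, lampertiSlope a σ (x s) :=
        intervalIntegral.integral_congr fun s hs => by
          rw [uIcc_of_le ht.2] at hs
          simp only [hx' s ⟨ht.1.trans hs.1, hs.2⟩]
      simp only [he' t ht, hx' t ht, hx' 1 h1, e3]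
    rwa [e1, e2, hx' 1 h1, hy' 1 h1] at key
  · intro t ht
    have e1 : (∫ s in (0 : ℝ)..t, (a (x' s) * (σ (x' s))⁻¹ - a (y' s) * (σ (y' s))⁻¹))
        = ∫ s in (0 : ℝ)..t, (a (x s) * (σ (x s))⁻¹ - a (y s) * (σ (y s))⁻¹) :=
      intervalIntegral.integral_congr fun s hs => by
        rw [uIcc_of_le ht.1] at hs
        have hs' : s ∈ Icc (0 : ℝ) 1 := ⟨hs.1, hs.2.trans ht.2⟩
        simp only [hx' s hs', hy' s hs']
    rw [e1, hx' t ht, hy' t ht, he' t ht, intervalIntegral.integral_sub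
      (intervalIntegrable_of_continuousOn_unit (hx.continuousOn_drift h) h0 ht)
      (intervalIntegrable_of_continuousOn_unit (hy.continuousOn_drift h) h0 ht)]
    linarith [hx.eq t ht, hy.eq t ht]

end CoefficientBounds

/-! ### Hölder continuity of fractional Brownian paths (Kolmogorov-Chentsov). -/

theorem abs_sub_floor_div_le {t : ℝ} (ht : 0 ≤ t) (m : ℕ) :
    |(⌊(2 : ℝ) ^ m * t⌋₊ : ℝ) / 2 ^ m - t| ≤ (1 / 2) ^ m := by
  have h2 : (0 : ℝ) < 2 ^ m := by positivity
  have h1 := Nat.floor_le (mul_nonneg h2.le ht)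
  have h3 := Nat.lt_floor_add_one ((2 : ℝ) ^ m * t)
  have e : (⌊(2 : ℝ) ^ m * t⌋₊ : ℝ) / 2 ^ m - t = (⌊(2 : ℝ) ^ m * t⌋₊ - 2 ^ m * t) / 2 ^ m := by
    field_simp
  rw [e, abs_div, abs_of_pos h2, one_div, inv_pow, ← one_div]
  refine div_le_div_of_nonneg_right ?_ h2.le
  rw [abs_le]
  constructor <;> linarith

/-- A continuous function whose dyadic increments are Hölder is Hölder. -/
theorem exists_unitHolder_of_dyadic {f : ℝ → ℝ} {K β : ℝ} (hf : ContinuousOn f (Icc 0 1))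
    (hβ : 0 < β) (hd : ∀ m k : ℕ, k < 2 ^ m →
      |f (((k + 1 : ℕ) : ℝ) / 2 ^ m) - f ((k : ℝ) / 2 ^ m)| ≤ K * (((1 : ℝ) / 2) ^ β) ^ m) :
    ∃ K', UnitHolder K' β f := by
  set r : ℝ := (1 / 2) ^ β with hr
  have hr0 : 0 < r := by positivity
  have hr1 : r < 1 := Real.rpow_lt_one (by norm_num) (by norm_num) hβ
  have hK : 0 ≤ K := by
    have := hd 0 0 (by simp)
    simp only [pow_zero, mul_one] at this
    exact (abs_nonneg _).trans this
  set d : ℝ → ℕ → ℝ := fun t m => (⌊(2 : ℝ) ^ m * t⌋₊ : ℝ) / 2 ^ m with hdef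
  have hfloor : ∀ t ∈ Icc (0 : ℝ) 1, ∀ m, ⌊(2 : ℝ) ^ m * t⌋₊ ≤ 2 ^ m := by
    intro t ht m
    refine Nat.floor_le_of_le ?_
    push_cast
    exact mul_le_of_le_one_right (by positivity) ht.2
  have hdmem : ∀ t ∈ Icc (0 : ℝ) 1, ∀ m, d t m ∈ Icc (0 : ℝ) 1 := by
    intro t ht m
    refine ⟨by positivity, div_le_one_of_le₀ ?_ (by positivity)⟩
    exact_mod_cast hfloor t ht m
  -- The dyadic floors of `t` at levels `m` and `m + 1` coincide or are neighbours at level `m + 1`,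
  -- so the values along them form a geometrically Cauchy sequence.
  have hstep : ∀ t ∈ Icc (0 : ℝ) 1, ∀ m, dist (f (d t m)) (f (d t (m + 1))) ≤ K * r ^ m := by
    intro t ht m
    have hdiv : ⌊(2 : ℝ) ^ (m + 1) * t⌋₊ / 2 = ⌊(2 : ℝ) ^ m * t⌋₊ := by
      rw [← Nat.floor_div_natCast]
      congr 1
      push_cast
      ring
    set j := ⌊(2 : ℝ) ^ (m + 1) * t⌋₊ with hj
    have hdt : d t m = ((2 * (j / 2) : ℕ) : ℝ) / 2 ^ (m + 1) := by
      simp only [hdef, ← hdiv]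
      push_cast
      rw [pow_succ]
      field_simp
    have hdt' : d t (m + 1) = (j : ℝ) / 2 ^ (m + 1) := rfl
    rw [hdt, hdt']
    rcases Nat.even_or_odd' j with ⟨c, hc | hc⟩
    · rw [show 2 * (j / 2) = j by omega, dist_self]
      positivity
    · have h1 := hfloor t ht (m + 1)
      rw [← hj] at h1
      rw [show 2 * (j / 2) = 2 * c by omega, hc, dist_comm, Real.dist_eq]
      refine (hd (m + 1) (2 * c) (by omega)).trans (mul_le_mul_of_nonneg_left ?_ hK)
      exact pow_le_pow_of_le_one hr0.le hr1.le (Nat.le_succ m)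
  have hlim : ∀ t ∈ Icc (0 : ℝ) 1, ∀ m, |f (d t m) - f t| ≤ K * r ^ m / (1 - r) := by
    intro t ht m
    refine dist_le_of_le_geometric_of_tendsto r K hr1 (hstep t ht) ?_ m
    have h1 : Filter.Tendsto (d t) Filter.atTop (nhdsWithin t (Icc 0 1)) := by
      refine tendsto_nhdsWithin_iff.2 ⟨?_, Filter.Eventually.of_forall (hdmem t ht)⟩
      refine tendsto_iff_norm_sub_tendsto_zero.2 (squeeze_zero (fun _ => norm_nonneg _)
        (fun m => abs_sub_floor_div_le ht.1 m)
        (tendsto_pow_atTop_nhds_zero_of_lt_one (by norm_num) (by norm_num)))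
    exact (hf t ht).tendsto.comp h1
  set C := 2 * (K / (1 - r)) + K with hC
  have hC0 : 0 ≤ C := by
    have : 0 ≤ K / (1 - r) := div_nonneg hK (by linarith)
    positivity
  have key : ∀ s ∈ Icc (0 : ℝ) 1, ∀ t ∈ Icc (0 : ℝ) 1, s ≤ t →
      |f t - f s| ≤ C / r * |t - s| ^ β := by
    intro s hs t ht hst
    rcases hst.eq_or_lt with rfl | hlt
    · rw [sub_self, abs_zero]
      positivity
    -- At the level with 2^{-(m+1)} < t - s ≤ 2^{-m} the floors of `s` and `t` are equal or
    -- adjacent.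
    obtain ⟨m, hm1, hm2⟩ := exists_nat_pow_near_of_lt_one (sub_pos.2 hlt)
      (by linarith [hs.1, ht.2] : t - s ≤ 1) (by norm_num : (0 : ℝ) < 1 / 2) (by norm_num)
    have hmid : |f (d t m) - f (d s m)| ≤ K * r ^ m := by
      have h2 : (0 : ℝ) < 2 ^ m := by positivity
      have hkl : ⌊(2 : ℝ) ^ m * s⌋₊ ≤ ⌊(2 : ℝ) ^ m * t⌋₊ :=
        Nat.floor_le_floor (mul_le_mul_of_nonneg_left hst h2.le)
      have hlk : ⌊(2 : ℝ) ^ m * t⌋₊ ≤ ⌊(2 : ℝ) ^ m * s⌋₊ + 1 := by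
        rw [← Nat.floor_add_one (mul_nonneg h2.le hs.1)]
        refine Nat.floor_le_floor ?_
        have : (2 : ℝ) ^ m * (t - s) ≤ 2 ^ m * (1 / 2) ^ m :=
          mul_le_mul_of_nonneg_left hm2 h2.le
        rw [← mul_pow] at this
        norm_num at this
        linarith
      have hl := hfloor t ht m
      simp only [hdef]
      rcases Nat.le_succ_iff_eq_or_le.1 hlk with h | h
      · rw [h]
        exact hd m _ (by omega)
      · rw [le_antisymm h hkl, sub_self, abs_zero]
        positivity
    have hrm : r ^ m ≤ r⁻¹ * |t - s| ^ β := by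
      rw [← div_le_iff₀' (inv_pos.2 hr0), div_inv_eq_mul, ← pow_succ, hr, ← Real.rpow_natCast,
        ← Real.rpow_mul (by norm_num), mul_comm, Real.rpow_mul (by norm_num), Real.rpow_natCast,
        abs_of_pos (sub_pos.2 hlt)]
      exact Real.rpow_le_rpow (by positivity) hm1.le hβ.le
    have e : f t - f s = -(f (d t m) - f t) + (f (d t m) - f (d s m)) + (f (d s m) - f s) := by
      ring
    have h3 := hlim t ht m
    have h4 := hlim s hs m
    calc |f t - f s| ≤ K * r ^ m / (1 - r) + K * r ^ m + K * r ^ m / (1 - r) := by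
          rw [e]
          refine (abs_add_le _ _).trans (add_le_add ((abs_add_le _ _).trans
            (add_le_add ?_ hmid)) h4)
          rwa [abs_neg]
      _ = C * r ^ m := by rw [hC]; ring
      _ ≤ C * (r⁻¹ * |t - s| ^ β) := mul_le_mul_of_nonneg_left hrm hC0
      _ = _ := by ring
  refine ⟨C / r, fun s hs t ht => ?_⟩
  rcases le_total s t with hst | hst
  · exact key s hs t ht hst
  · rw [abs_sub_comm, abs_sub_comm t]
    exact key t ht s hs hst

namespace IsFractionalBrownianMotion

variable {Ω : Type*} [MeasurableSpace Ω] {H : ℝ} {B : ℝ → Ω → ℝ} {P : Measure Ω}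

theorem aemeasurable (hB : IsFractionalBrownianMotion H B P) {t : ℝ} (ht : t ∈ Icc (0 : ℝ) 1) :
    AEMeasurable (B t) P :=
  hB.isGaussianProcess.aemeasurable ⟨t, ht⟩

theorem memLp (hB : IsFractionalBrownianMotion H B P) {t : ℝ} (ht : t ∈ Icc (0 : ℝ) 1) :
    MemLp (B t) 2 P :=
  (hB.isGaussianProcess.hasGaussianLaw_eval ⟨t, ht⟩).memLp_two

/-- Writing the law as a scaled standard Gaussian makes every L^p norm of an increment a multiple of
|t - s|^H, the degenerate case `s = t` included. -/
theorem map_increment (hB : IsFractionalBrownianMotion H B P) (hH : 0 < H) {s t : ℝ}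
    (hs : s ∈ Icc (0 : ℝ) 1) (ht : t ∈ Icc (0 : ℝ) 1) :
    P.map (fun ω => B t ω - B s ω) = (gaussianReal 0 1).map (fun z => |t - s| ^ H * z) := by
  have : IsProbabilityMeasure P := hB.isGaussianProcess.isProbabilityMeasure
  have hg : HasGaussianLaw (fun ω => B t ω - B s ω) P :=
    hB.isGaussianProcess.hasGaussianLaw_fun_sub (s := ⟨t, ht⟩) (t := ⟨s, hs⟩)
  have is := (hB.memLp hs).integrable one_le_two
  have it := (hB.memLp ht).integrable one_le_two
  have hmean : ∫ ω, (B t ω - B s ω) ∂P = 0 := by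
    rw [integral_sub it is, hB.centered t ht, hB.centered s hs, sub_zero]
  have hvar : Var[fun ω => B t ω - B s ω; P] = |t - s| ^ (2 * H) := by
    rw [variance_of_integral_eq_zero hg.aemeasurable hmean]
    have e : ∀ ω, (B t ω - B s ω) ^ 2 = B t ω * B t ω - 2 * (B s ω * B t ω) + B s ω * B s ω :=
      fun ω => by ring
    have i1 : Integrable (fun ω => B t ω * B t ω) P := (hB.memLp ht).integrable_mul (hB.memLp ht)
    have i2 : Integrable (fun ω => B s ω * B t ω) P := (hB.memLp hs).integrable_mul (hB.memLp ht)
    have i3 : Integrable (fun ω => B s ω * B s ω) P := (hB.memLp hs).integrable_mul (hB.memLp hs)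
    simp_rw [e]
    have i4 : Integrable (fun ω => B t ω * B t ω - 2 * (B s ω * B t ω)) P :=
      i1.sub (i2.const_mul 2)
    rw [integral_add i4 i3, integral_sub i1 (i2.const_mul 2),
      integral_const_mul, hB.covariance t ht t ht, hB.covariance s hs t ht, hB.covariance s hs s hs,
      sub_self, sub_self, abs_zero, Real.zero_rpow (by positivity)]
    ring
  rw [hg.map_eq_gaussianReal, hmean, hvar, gaussianReal_map_const_mul, mul_zero, mul_one]
  congr 1
  rw [← NNReal.coe_inj, Real.coe_toNNReal _ (by positivity)]
  change _ = (|t - s| ^ H) ^ 2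
  rw [← Real.rpow_natCast, ← Real.rpow_mul (abs_nonneg _)]
  congr 1
  push_cast
  ring

theorem eLpNorm_increment (hB : IsFractionalBrownianMotion H B P) (hH : 0 < H) {s t : ℝ}
    (hs : s ∈ Icc (0 : ℝ) 1) (ht : t ∈ Icc (0 : ℝ) 1) (p : ENNReal) :
    eLpNorm (fun ω => B t ω - B s ω) p P
      = ENNReal.ofReal (|t - s| ^ H) * eLpNorm id p (gaussianReal 0 1) := by
  have h1 : eLpNorm id p (P.map fun ω => B t ω - B s ω) = eLpNorm (fun ω => B t ω - B s ω) p P :=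
    eLpNorm_map_measure aestronglyMeasurable_id
      ((hB.aemeasurable ht).sub (hB.aemeasurable hs))
  rw [← h1, hB.map_increment hH hs ht, eLpNorm_map_measure aestronglyMeasurable_id (by fun_prop)]
  have h2 := eLpNorm_const_smul (|t - s| ^ H) (id : ℝ → ℝ) p (gaussianReal 0 1)
  rw [Real.enorm_eq_ofReal (by positivity)] at h2
  exact h2

/-- Paths of fractional Brownian motion are Hölder of every order less than the Hurst parameter. -/
theorem ae_exists_unitHolder (hB : IsFractionalBrownianMotion H B P) {β : ℝ} (hβ : 0 < β)
    (hβH : β < H) : ∀ᵐ ω ∂P, ∃ K, UnitHolder K β (fun t => B t ω) := by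
  -- With p(H - β) > 1 the decay 2^{-m(H-β)p} of the normalized p-th moments beats the number 2^m of
  -- dyadic increments at level `m`.
  obtain ⟨p, hp⟩ := exists_nat_gt (1 / (H - β))
  have hHβ : 0 < H - β := sub_pos.2 hβH
  have hp0 : (0 : ℝ) < p := lt_trans (by positivity) hp
  have hp1 : p ≠ 0 := by exact_mod_cast hp0.ne'
  set N := eLpNorm id (p : ENNReal) (gaussianReal 0 1) with hN
  have hNtop : N ≠ ⊤ := (memLp_id_gaussianReal' p (by simp)).eLpNorm_ne_top
  set r : ℝ := (1 / 2) ^ β with hr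
  have hr0 : 0 < r := by positivity
  set q : ℝ := (1 / 2) ^ H with hq
  have hq0 : 0 < q := by positivity
  have hθ : 2 * (q / r) ^ p < 1 := by
    rw [hq, hr, ← Real.rpow_sub (by norm_num), ← Real.rpow_natCast, ← Real.rpow_mul (by norm_num)]
    have h1 : 1 < (H - β) * p := by rwa [div_lt_iff₀ hHβ, mul_comm] at hp
    have := Real.rpow_lt_rpow_of_exponent_gt (x := 1 / 2) (by norm_num) (by norm_num) h1
    rw [Real.rpow_one] at this
    linarith
  set D : ℕ → ℕ → Ω → ℝ := fun m k ω =>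
    B (((k + 1 : ℕ) : ℝ) / 2 ^ m) ω - B ((k : ℝ) / 2 ^ m) ω with hD
  have hmem : ∀ m k : ℕ, k ≤ 2 ^ m → (k : ℝ) / 2 ^ m ∈ Icc (0 : ℝ) 1 := fun m k hk =>
    ⟨by positivity, div_le_one_of_le₀ (by exact_mod_cast hk) (by positivity)⟩
  have hDm : ∀ m k : ℕ, k < 2 ^ m → AEMeasurable (fun ω => ‖D m k ω‖ₑ ^ p) P := fun m k hk =>
    (((hB.aemeasurable (hmem m (k + 1) hk)).sub
      (hB.aemeasurable (hmem m k hk.le))).enorm).pow_const p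
  have hDint : ∀ m k : ℕ, k < 2 ^ m →
      ∫⁻ ω, ‖D m k ω‖ₑ ^ p ∂P = (ENNReal.ofReal (q ^ m) * N) ^ p := by
    intro m k hk
    have h1 := hB.eLpNorm_increment (hβ.trans hβH) (hmem m k hk.le) (hmem m (k + 1) hk) p
    have h2 : |((k + 1 : ℕ) : ℝ) / 2 ^ m - (k : ℝ) / 2 ^ m| ^ H = q ^ m := by
      rw [← sub_div, Nat.cast_succ, add_sub_cancel_left, abs_of_pos (by positivity), hq,
        Real.rpow_pow_comm (by norm_num), one_div_pow]
    rw [h2] at h1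
    rw [hN, ← h1, eLpNorm_eq_lintegral_rpow_enorm_toReal (by simpa using hp1) (by simp)]
    simp only [ENNReal.toReal_natCast, ENNReal.rpow_natCast, one_div]
    rw [← ENNReal.rpow_natCast, ENNReal.rpow_inv_rpow hp0.ne']
  -- A single integrable variable that dominates the p-th powers of all normalized dyadic
  -- increments.
  set Z : Ω → ENNReal := fun ω => ∑' m : ℕ, ∑ k ∈ Finset.range (2 ^ m),
    ENNReal.ofReal ((r⁻¹) ^ (m * p)) * ‖D m k ω‖ₑ ^ p with hZ
  have hZm : ∀ m : ℕ, AEMeasurable (fun ω => ∑ k ∈ Finset.range (2 ^ m),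
      ENNReal.ofReal ((r⁻¹) ^ (m * p)) * ‖D m k ω‖ₑ ^ p) P := fun m =>
    Finset.aemeasurable_fun_sum _ fun k hk => (hDm m k (Finset.mem_range.1 hk)).const_mul _
  have hZint : ∫⁻ ω, Z ω ∂P ≠ ⊤ := by
    have e : ∫⁻ ω, Z ω ∂P = N ^ p * ∑' m : ℕ, ENNReal.ofReal (2 * (q / r) ^ p) ^ m := by
      rw [lintegral_tsum hZm, ← ENNReal.tsum_mul_left]
      congr 1
      ext m
      rw [lintegral_finsetSum' _ fun k hk => (hDm m k (Finset.mem_range.1 hk)).const_mul _,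
        Finset.sum_congr rfl fun k hk => by
          rw [lintegral_const_mul'' _ (hDm m k (Finset.mem_range.1 hk)),
            hDint m k (Finset.mem_range.1 hk)]]
      rw [Finset.sum_const, Finset.card_range, nsmul_eq_mul, mul_pow, ← ENNReal.ofReal_pow
        (by positivity), ← ENNReal.ofReal_pow (by positivity), ← ENNReal.ofReal_natCast]
      rw [← mul_assoc, ← mul_assoc, ← ENNReal.ofReal_mul (by positivity),
        ← ENNReal.ofReal_mul (by positivity), mul_comm]
      congr 2
      push_cast
      rw [mul_pow, div_pow, div_pow, ← pow_mul, ← pow_mul, inv_pow, mul_comm p m]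
      ring
    rw [e, ENNReal.tsum_geometric]
    refine ENNReal.mul_ne_top (ENNReal.pow_ne_top hNtop) (ENNReal.inv_ne_top.2 ?_)
    exact (tsub_pos_of_lt (by rwa [← ENNReal.ofReal_one, ENNReal.ofReal_lt_ofReal_iff one_pos])).ne'
  filter_upwards [ae_lt_top' (AEMeasurable.tsum hZm) hZint, hB.continuous_paths] with ω hω hc
  have hω : Z ω ≠ ⊤ := hω.ne
  -- The constant 1 + Z replaces the p-th root of Z, since Z < 1 + Z ≤ (1 + Z)^p.
  refine exists_unitHolder_of_dyadic (K := 1 + (Z ω).toReal) hc hβ fun m k hk => ?_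
  have h1 : ENNReal.ofReal ((r⁻¹) ^ (m * p)) * ‖D m k ω‖ₑ ^ p ≤ Z ω := by
    refine le_trans ?_ (ENNReal.le_tsum m)
    exact Finset.single_le_sum (f := fun k => ENNReal.ofReal ((r⁻¹) ^ (m * p)) * ‖D m k ω‖ₑ ^ p)
      (fun _ _ => bot_le) (Finset.mem_range.2 hk)
  have h2 : ((r⁻¹) ^ m * |D m k ω|) ^ p ≤ (Z ω).toReal := by
    rw [mul_pow, ← pow_mul]
    rw [← ENNReal.ofReal_le_iff_le_toReal hω, ENNReal.ofReal_mul (by positivity)]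
    refine le_trans (le_of_eq ?_) h1
    rw [← Real.norm_eq_abs, ENNReal.ofReal_pow (norm_nonneg _), ofReal_norm]
  have hz : 0 ≤ (Z ω).toReal := ENNReal.toReal_nonneg
  have h3 : (r⁻¹) ^ m * |D m k ω| ≤ 1 + (Z ω).toReal := by
    by_contra hlt
    push Not at hlt
    have h4 : (1 + (Z ω).toReal) ^ p < ((r⁻¹) ^ m * |D m k ω|) ^ p :=
      pow_lt_pow_left₀ hlt (by linarith) hp1
    have h5 : 1 + (Z ω).toReal ≤ (1 + (Z ω).toReal) ^ p := le_self_pow₀ (by linarith) hp1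
    linarith
  change |D m k ω| ≤ _
  rw [inv_pow, inv_mul_le_iff₀ (by positivity)] at h3
  linarith

end IsFractionalBrownianMotion

/-! ### Pathwise time integrals as limits of Riemann sums. -/

/-- Left Riemann sums over the uniform partition of `[s, t]` into `m + 1` intervals. -/
noncomputable def uniformRiemannSum (s t : ℝ) (m : ℕ) (f : ℝ → ℝ) : ℝ :=
  (t - s) / (m + 1) * ∑ i ∈ Finset.range (m + 1), f (s + i * ((t - s) / (m + 1)))

theorem add_mul_div_mem_Icc {s t : ℝ} (hst : s ≤ t) {m i : ℕ} (hi : i ≤ m + 1) :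
    s + i * ((t - s) / (m + 1)) ∈ Icc s t := by
  have h0 : 0 ≤ t - s := sub_nonneg.2 hst
  have hm : (0 : ℝ) < m + 1 := by positivity
  refine ⟨by linarith [show 0 ≤ i * ((t - s) / (m + 1)) by positivity], ?_⟩
  have : (i : ℝ) * ((t - s) / (m + 1)) ≤ (m + 1) * ((t - s) / (m + 1)) := by
    gcongr
    exact_mod_cast hi
  rw [mul_div_cancel₀ _ hm.ne'] at this
  linarith

theorem tendsto_uniformRiemannSum {f : ℝ → ℝ} {s t : ℝ} (hst : s ≤ t)
    (hf : ContinuousOn f (Icc s t)) :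
    Filter.Tendsto (fun m => uniformRiemannSum s t m f) Filter.atTop
      (nhds (∫ r in s..t, f r)) := by
  rw [Metric.tendsto_atTop]
  intro ε hε
  have h0 : 0 ≤ t - s := sub_nonneg.2 hst
  have hη : 0 < ε / (t - s + 1) := by positivity
  obtain ⟨δ, hδ, huc⟩ := Metric.uniformContinuousOn_iff.1
    (isCompact_Icc.uniformContinuousOn_of_continuous hf) _ hη
  obtain ⟨N, hN⟩ := exists_nat_gt ((t - s) / δ)
  refine ⟨N, fun m hm => ?_⟩
  have hm0 : (0 : ℝ) < m + 1 := by positivity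
  set k := (t - s) / (m + 1) with hk
  have hk0 : 0 ≤ k := by positivity
  have hkδ : k < δ := by
    rw [div_lt_iff₀ hδ] at hN
    rw [hk, div_lt_iff₀ hm0]
    have : (N : ℝ) ≤ m := by exact_mod_cast hm
    nlinarith
  have hmk : (m + 1) * k = t - s := mul_div_cancel₀ _ hm0.ne'
  set u : ℕ → ℝ := fun i => s + i * k with hu
  have hustep : ∀ i, u (i + 1) - u i = k := fun i => by simp only [hu]; push_cast; ring
  have humem : ∀ i ≤ m + 1, u i ∈ Icc s t := fun i hi => add_mul_div_mem_Icc hst hi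
  have hii : ∀ i < m + 1, IntervalIntegrable f volume (u i) (u (i + 1)) := fun i hi =>
    (hf.mono (uIcc_subset_Icc (humem i hi.le) (humem (i + 1) hi))).intervalIntegrable
  have e : uniformRiemannSum s t m f - ∫ r in s..t, f r
      = ∑ i ∈ Finset.range (m + 1), ∫ r in (u i)..(u (i + 1)), (f (u i) - f r) := by
    rw [Finset.sum_congr rfl fun i hi => intervalIntegral.integral_sub
      intervalIntegrable_const (hii i (Finset.mem_range.1 hi)), Finset.sum_sub_distrib,
      intervalIntegral.sum_integral_adjacent_intervals hii, uniformRiemannSum, Finset.mul_sum]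
    have e0 : u 0 = s := by simp [hu]
    have e1 : u (m + 1) = t := by
      simp only [hu]
      push_cast
      linarith
    rw [e0, e1]
    congr 1
    refine Finset.sum_congr rfl fun i _ => ?_
    rw [intervalIntegral.integral_const, hustep i, smul_eq_mul]
  rw [Real.dist_eq, e]
  have hb : ∀ i ∈ Finset.range (m + 1), |∫ r in (u i)..(u (i + 1)), (f (u i) - f r)|
      ≤ ε / (t - s + 1) * k := by
    intro i hi
    have hi := Finset.mem_range.1 hi
    rw [← hustep i]
    refine abs_integral_le_mul (by linarith [hustep i]) fun r hr => ?_
    refine (huc _ (humem i hi.le) r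
      ⟨(humem i hi.le).1.trans hr.1, hr.2.trans (humem (i + 1) hi).2⟩ ?_).le
    rw [Real.dist_eq, abs_sub_comm, abs_of_nonneg (by linarith [hr.1])]
    linarith [hr.2, hustep i]
  refine ((Finset.abs_sum_le_sum_abs _ _).trans (Finset.sum_le_sum hb)).trans_lt ?_
  rw [Finset.sum_const, Finset.card_range, nsmul_eq_mul]
  push_cast
  rw [show ((m : ℝ) + 1) * (ε / (t - s + 1) * k) = ε / (t - s + 1) * ((m + 1) * k) by ring, hmk,
    div_mul_eq_mul_div, div_lt_iff₀ (by positivity)]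
  nlinarith

section RandomPaths

variable {Ω : Type*} [MeasurableSpace Ω] {P : Measure Ω} {Z : ℝ → Ω → ℝ} {s t : ℝ}

theorem aemeasurable_uniformRiemannSum (hst : s ≤ t) (hm : ∀ r ∈ Icc s t, AEMeasurable (Z r) P)
    (m : ℕ) : AEMeasurable (fun ω => uniformRiemannSum s t m fun r => Z r ω) P :=
  (Finset.aemeasurable_fun_sum _ fun _ hi =>
    hm _ (add_mul_div_mem_Icc hst (Finset.mem_range.1 hi).le)).const_mul _

theorem ae_tendsto_uniformRiemannSum (hst : s ≤ t)
    (hc : ∀ᵐ ω ∂P, ContinuousOn (fun r => Z r ω) (Icc s t)) :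
    ∀ᵐ ω ∂P, Filter.Tendsto (fun m => uniformRiemannSum s t m fun r => Z r ω) Filter.atTop
      (nhds (∫ r in s..t, Z r ω)) := by
  filter_upwards [hc] with ω hω using tendsto_uniformRiemannSum hst hω

/-- Only the time marginals are known to be measurable, not the process jointly, so the integral is
obtained as an almost sure limit of finite sums. -/
theorem aemeasurable_integral_of_continuousOn (hst : s ≤ t)
    (hc : ∀ᵐ ω ∂P, ContinuousOn (fun r => Z r ω) (Icc s t))
    (hm : ∀ r ∈ Icc s t, AEMeasurable (Z r) P) :
    AEMeasurable (fun ω => ∫ r in s..t, Z r ω) P :=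
  aemeasurable_of_tendsto_metrizable_ae Filter.atTop (aemeasurable_uniformRiemannSum hst hm)
    (ae_tendsto_uniformRiemannSum hst hc)

/-- Minkowski's integral inequality for processes with continuous paths. -/
theorem eLpNorm_integral_unit_le (hc : ∀ᵐ ω ∂P, ContinuousOn (fun r => Z r ω) (Icc 0 1))
    (hm : ∀ r ∈ Icc (0 : ℝ) 1, AEMeasurable (Z r) P) {p R : ENNReal} (hp : 1 ≤ p)
    (hR : ∀ r ∈ Icc (0 : ℝ) 1, eLpNorm (Z r) p P ≤ R) :
    eLpNorm (fun ω => ∫ r in (0 : ℝ)..1, Z r ω) p P ≤ R := by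
  -- Fatou's lemma for L^p norms reduces the bound to Riemann sums, where it is the triangle
  -- inequality.
  refine (Lp.eLpNorm_lim_le_liminf_eLpNorm
    (fun m => (aemeasurable_uniformRiemannSum zero_le_one hm m).aestronglyMeasurable) _
    (ae_tendsto_uniformRiemannSum zero_le_one hc)).trans ?_
  refine Filter.liminf_le_of_le (by isBoundedDefault) fun b hb => ?_
  obtain ⟨m, hbm⟩ := hb.exists
  refine hbm.trans ?_
  have h1 := eLpNorm_const_smul (((1 : ℝ) - 0) / (m + 1))
    (fun ω => ∑ i ∈ Finset.range (m + 1), Z (0 + i * ((1 - 0) / (m + 1))) ω) p P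
  have h2 : eLpNorm (fun ω => ∑ i ∈ Finset.range (m + 1), Z (0 + i * ((1 - 0) / (m + 1))) ω) p P
      ≤ (m + 1 : ℕ) * R := by
    have := eLpNorm_sum_le (f := fun i : ℕ => Z (0 + i * ((1 - 0) / (m + 1)))) (p := p) (μ := P)
      (s := Finset.range (m + 1)) (fun i hi => (hm _ (add_mul_div_mem_Icc zero_le_one
        (Finset.mem_range.1 hi).le)).aestronglyMeasurable) hp
    rw [show (fun ω => ∑ i ∈ Finset.range (m + 1), Z (0 + i * ((1 - 0) / (m + 1))) ω)
      = ∑ i ∈ Finset.range (m + 1), Z (0 + i * ((1 - 0) / (m + 1))) by ext; simp]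
    refine this.trans ((Finset.sum_le_sum fun i hi => hR _ (add_mul_div_mem_Icc zero_le_one
      (Finset.mem_range.1 hi).le)).trans ?_)
    rw [Finset.sum_const, Finset.card_range, nsmul_eq_mul]
  refine (le_of_eq h1).trans ((mul_le_mul_right h2 _).trans ?_)
  rw [← mul_assoc, Real.enorm_eq_ofReal (by positivity), ← ENNReal.ofReal_natCast,
    ← ENNReal.ofReal_mul (by positivity)]
  push_cast
  rw [sub_zero, one_div_mul_cancel (by positivity), ENNReal.ofReal_one, one_mul]

end RandomPaths

/-! ### Linear interpolation and the size of its error. -/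

/-- The real number `z` clipped to `[0, 1]`. -/
def clip (z : ℝ) : ℝ := max 0 (min 1 z)

theorem abs_clip_sub_le (y z : ℝ) : |clip y - clip z| ≤ |y - z| := by
  unfold clip
  rw [max_comm 0, max_comm 0, min_comm 1, min_comm 1]
  exact (abs_max_sub_max_le_abs _ _ _).trans (abs_min_sub_min_le_max _ _ _ _ |>.trans (by simp))

/-- Each summand is globally Lipschitz in `t`, so regularity of the interpolation follows without
comparing grid cells. The extra index `n` accommodates `t = 1`, where the floor equals `n`; its
weight is zero on `[0, 1]`. -/
theorem linearInterpolation_eq_sum {n : ℕ} (b : ℝ → ℝ) {t : ℝ} (ht : t ∈ Icc (0 : ℝ) 1) :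
    linearInterpolation n b t = b 0 + ∑ i ∈ Finset.range (n + 1),
      clip (n * t - i) * (b (((i : ℝ) + 1) / n) - b ((i : ℝ) / n)) := by
  set k := ⌊n * t⌋₊ with hk
  have hnt : 0 ≤ n * t := mul_nonneg (Nat.cast_nonneg _) ht.1
  have hk1 : (k : ℝ) ≤ n * t := Nat.floor_le hnt
  have hk2 : n * t < k + 1 := Nat.lt_floor_add_one _
  have hkn : k ≤ n := Nat.floor_le_of_le (mul_le_of_le_one_right (Nat.cast_nonneg _) ht.2)
  have key : ∀ N, k + 1 ≤ N → ∑ i ∈ Finset.range N,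
      clip (n * t - i) * (b (((i : ℝ) + 1) / n) - b ((i : ℝ) / n))
      = b ((k : ℝ) / n) - b 0 + (n * t - k) * (b (((k : ℝ) + 1) / n) - b ((k : ℝ) / n)) := by
    intro N hN
    induction N, hN using Nat.le_induction with
    | base =>
      rw [Finset.sum_range_succ]
      congr 1
      · have := Finset.sum_range_sub (fun i : ℕ => b ((i : ℝ) / n)) k
        simp only [Nat.cast_zero, zero_div] at this
        rw [← this]
        refine Finset.sum_congr rfl fun i hi => ?_
        have hi : (i : ℝ) + 1 ≤ k := by exact_mod_cast Finset.mem_range.1 hi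
        rw [clip, min_eq_left (by linarith), max_eq_right zero_le_one, one_mul, Nat.cast_succ]
      · rw [clip, min_eq_right (by linarith), max_eq_right (by linarith)]
    | succ N hN ih =>
      rw [Finset.sum_range_succ, ih]
      have : (k : ℝ) + 1 ≤ N := by exact_mod_cast hN
      rw [clip, min_eq_right (by linarith), max_eq_left (by linarith), zero_mul, add_zero]
  rw [key (n + 1) (by omega), linearInterpolation, ← hk]
  ring

theorem exists_unitHolder_linearInterpolation (n : ℕ) (b : ℝ → ℝ) {β : ℝ} (hβ : β ≤ 1) :
    ∃ K, UnitHolder K β (linearInterpolation n b) := by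
  refine ⟨∑ i ∈ Finset.range (n + 1), n * |b (((i : ℝ) + 1) / n) - b ((i : ℝ) / n)|,
    fun s hs t ht => ?_⟩
  rw [linearInterpolation_eq_sum b hs, linearInterpolation_eq_sum b ht, add_sub_add_left_eq_sub,
    ← Finset.sum_sub_distrib, Finset.sum_mul]
  refine (Finset.abs_sum_le_sum_abs _ _).trans (Finset.sum_le_sum fun i _ => ?_)
  rw [← sub_mul, abs_mul]
  have h1 : |clip (n * t - i) - clip (n * s - i)| ≤ n * |t - s| := by
    refine (abs_clip_sub_le _ _).trans (le_of_eq ?_)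
    rw [show (n : ℝ) * t - i - (n * s - i) = n * (t - s) by ring, abs_mul, Nat.abs_cast]
  have h2 : |t - s| ≤ |t - s| ^ β := by
    refine Real.self_le_rpow_of_le_one (abs_nonneg _) ?_ hβ
    rw [abs_le]
    constructor <;> linarith [hs.1, hs.2, ht.1, ht.2]
  calc _ ≤ n * |t - s| ^ β * |b (((i : ℝ) + 1) / n) - b ((i : ℝ) / n)| := by
        gcongr
        exact h1.trans (by gcongr)
    _ = _ := by ring

theorem UnitHolder.continuousOn {K β : ℝ} {f : ℝ → ℝ} (hf : UnitHolder K β f) (hβ : 0 < β) :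
    ContinuousOn f (Icc 0 1) := by
  intro t ht
  refine tendsto_iff_norm_sub_tendsto_zero.2 (squeeze_zero' (Filter.Eventually.of_forall
    fun _ => norm_nonneg _) (g := fun s => K * |s - t| ^ β) ?_ ?_)
  · filter_upwards [self_mem_nhdsWithin] with s hs using hf t ht s hs
  · have : Continuous fun s : ℝ => K * |s - t| ^ β :=
      continuous_const.mul ((continuous_id.sub continuous_const).abs.rpow_const
        fun _ => Or.inr hβ.le)
    have h := this.tendsto t
    rw [sub_self, abs_zero, Real.zero_rpow hβ.ne', mul_zero] at h
    exact h.mono_left nhdsWithin_le_nhds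

theorem linearInterpolation_zero (n : ℕ) (b : ℝ → ℝ) : linearInterpolation n b 0 = b 0 := by
  simp [linearInterpolation]

theorem linearInterpolation_one {n : ℕ} (hn : 1 ≤ n) (b : ℝ → ℝ) :
    linearInterpolation n b 1 = b 1 := by
  have : (n : ℝ) ≠ 0 := by positivity
  simp [linearInterpolation, this]

theorem floor_div_mem_unit {n : ℕ} {t : ℝ} (ht : t ∈ Icc (0 : ℝ) 1) :
    (⌊n * t⌋₊ : ℝ) / n ∈ Icc (0 : ℝ) 1 := by
  refine ⟨by positivity, div_le_one_of_le₀ ?_ (Nat.cast_nonneg _)⟩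
  exact_mod_cast Nat.floor_le_of_le (mul_le_of_le_one_right (Nat.cast_nonneg _) ht.2)

namespace IsFractionalBrownianMotion

variable {Ω : Type*} [MeasurableSpace Ω] {H : ℝ} {B : ℝ → Ω → ℝ} {P : Measure Ω}

theorem aemeasurable_interpolation_error (hB : IsFractionalBrownianMotion H B P) {n : ℕ}
    (hn : 1 ≤ n) {t : ℝ} (ht : t ∈ Icc (0 : ℝ) 1) :
    AEMeasurable (fun ω => B t ω - linearInterpolation n (fun s => B s ω) t) P := by
  -- At `t = 1` the right node (n + 1)/n lies outside `[0, 1]`, where nothing is known about `B`;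
  -- there the error vanishes identically.
  rcases ht.2.eq_or_lt with rfl | ht1
  · simp [linearInterpolation_one hn]
  have hn0 : (0 : ℝ) < n := by exact_mod_cast hn
  have hk : ((⌊n * t⌋₊ : ℝ) + 1) / n ∈ Icc (0 : ℝ) 1 := by
    refine ⟨by positivity, div_le_one_of_le₀ ?_ hn0.le⟩
    have : ⌊n * t⌋₊ < n := (Nat.floor_lt (by have := ht.1; positivity)).2
      (mul_lt_of_lt_one_right hn0 ht1)
    exact_mod_cast this
  have m1 := hB.aemeasurable (floor_div_mem_unit (n := n) ht)
  exact (hB.aemeasurable ht).sub (m1.add (((hB.aemeasurable hk).sub m1).const_mul _))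

theorem eLpNorm_interpolation_error_le (hB : IsFractionalBrownianMotion H B P) (hH : 0 < H) {n : ℕ}
    (hn : 1 ≤ n) {t : ℝ} (ht : t ∈ Icc (0 : ℝ) 1) {p : ENNReal} (hp : 1 ≤ p) :
    eLpNorm (fun ω => B t ω - linearInterpolation n (fun s => B s ω) t) p P
      ≤ 2 * (ENNReal.ofReal ((n : ℝ) ^ (-H)) * eLpNorm id p (gaussianReal 0 1)) := by
  rcases ht.2.eq_or_lt with rfl | ht1
  · simp [linearInterpolation_one hn]
  have hn0 : (0 : ℝ) < n := by exact_mod_cast hn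
  have hnt : 0 ≤ n * t := mul_nonneg hn0.le ht.1
  have hk1 : (⌊n * t⌋₊ : ℝ) ≤ n * t := Nat.floor_le hnt
  have hk2 : n * t < ⌊n * t⌋₊ + 1 := Nat.lt_floor_add_one _
  have hk : ((⌊n * t⌋₊ : ℝ) + 1) / n ∈ Icc (0 : ℝ) 1 := by
    refine ⟨by positivity, div_le_one_of_le₀ ?_ hn0.le⟩
    have : ⌊n * t⌋₊ < n := (Nat.floor_lt hnt).2 (mul_lt_of_lt_one_right hn0 ht1)
    exact_mod_cast this
  have hk' := floor_div_mem_unit (n := n) ht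
  set k : ℝ := (⌊n * t⌋₊ : ℝ) with hkdef
  have m1 := ((hB.aemeasurable ht).sub (hB.aemeasurable hk')).aestronglyMeasurable
  have m2 := ((hB.aemeasurable hk).sub (hB.aemeasurable hk')).aestronglyMeasurable
  have e : (fun ω => B t ω - linearInterpolation n (fun s => B s ω) t)
      = (fun ω => B t ω - B (k / n) ω) - (n * t - k) • fun ω => B ((k + 1) / n) ω - B (k / n) ω := by
    ext ω
    simp only [linearInterpolation, ← hkdef, Pi.sub_apply, Pi.smul_apply, smul_eq_mul]
    ring
  have hinv : (n : ℝ) ^ (-H) = (1 / n) ^ H := by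
    rw [Real.rpow_neg hn0.le, one_div, Real.inv_rpow hn0.le]
  have b1 : eLpNorm (fun ω => B t ω - B (k / n) ω) p P
      ≤ ENNReal.ofReal ((n : ℝ) ^ (-H)) * eLpNorm id p (gaussianReal 0 1) := by
    rw [hB.eLpNorm_increment hH hk' ht, hinv]
    refine mul_le_mul_left (ENNReal.ofReal_le_ofReal
      (Real.rpow_le_rpow (abs_nonneg _) ?_ hH.le)) _
    have : t - k / n = (n * t - k) / n := by field_simp
    rw [this, abs_div, abs_of_pos hn0]
    refine div_le_div_of_nonneg_right ?_ hn0.le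
    rw [abs_le]
    constructor <;> linarith
  have b2 : eLpNorm ((n * t - k) • fun ω => B ((k + 1) / n) ω - B (k / n) ω) p P
      ≤ ENNReal.ofReal ((n : ℝ) ^ (-H)) * eLpNorm id p (gaussianReal 0 1) := by
    rw [eLpNorm_const_smul, hB.eLpNorm_increment hH hk' hk, hinv, ← sub_div, add_sub_cancel_left,
      abs_of_pos (by positivity)]
    refine mul_le_of_le_one_left' ?_
    rw [Real.enorm_eq_ofReal (by linarith), ← ENNReal.ofReal_one]
    exact ENNReal.ofReal_le_ofReal (by linarith)
  rw [e, two_mul]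
  exact (eLpNorm_sub_le m1 (m2.const_smul _) hp).trans (add_le_add b1 b2)

/-- The mean-square size of the squared `L²([0,1])` norm of the interpolation error. -/
theorem eLpNorm_integral_sq_interpolation_error_le (hB : IsFractionalBrownianMotion H B P)
    (hH : 0 < H) {n : ℕ} (hn : 1 ≤ n)
    (hc : ∀ᵐ ω ∂P, ContinuousOn (fun t => B t ω - linearInterpolation n (fun s => B s ω) t)
      (Icc 0 1)) :
    eLpNorm (fun ω => ∫ t in (0 : ℝ)..1,
      (B t ω - linearInterpolation n (fun s => B s ω) t) ^ 2) 2 P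
      ≤ ENNReal.ofReal ((2 * (eLpNorm id 4 (gaussianReal 0 1)).toReal) ^ 2
        * (n : ℝ) ^ (-(2 * H))) := by
  refine eLpNorm_integral_unit_le ?_ (fun t ht =>
    (hB.aemeasurable_interpolation_error hn ht).pow_const 2) one_le_two fun t ht => ?_
  · filter_upwards [hc] with ω hω using hω.pow 2
  have hN : eLpNorm id 4 (gaussianReal 0 1) ≠ ⊤ :=
    (memLp_id_gaussianReal' 4 (by simp)).eLpNorm_ne_top
  -- The fourth moment enters because the L² norm of a square is the squared L⁴ norm.
  have h1 := hB.eLpNorm_interpolation_error_le hH hn ht (p := 4) (by norm_num)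
  have h2 := eLpNorm_norm_rpow (p := 2) (μ := P)
    (fun ω => B t ω - linearInterpolation n (fun s => B s ω) t) two_pos
  simp only [Real.rpow_two, Real.norm_eq_abs, sq_abs] at h2
  rw [h2, show (2 : ENNReal) * ENNReal.ofReal 2 = 4 by norm_num]
  refine (ENNReal.rpow_le_rpow h1 zero_le_two).trans (le_of_eq ?_)
  have hn0 : (0 : ℝ) < n := by exact_mod_cast hn
  rw [← ENNReal.ofReal_toReal hN, ENNReal.toReal_ofReal ENNReal.toReal_nonneg,
    ← ENNReal.ofReal_mul (by positivity),
    show (2 : ENNReal) = ENNReal.ofReal 2 by simp, ← ENNReal.ofReal_mul (by positivity),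
    ENNReal.ofReal_rpow_of_nonneg (by positivity) zero_le_two, Real.rpow_two]
  congr 1
  rw [show -(2 * H) = -H * (2 : ℕ) by push_cast; ring, Real.rpow_mul hn0.le, Real.rpow_natCast]
  ring

end IsFractionalBrownianMotion

/-! ### From pathwise bounds to mean-square bounds. -/

section SquareIntegrable

variable {Ω : Type*} [MeasurableSpace Ω] {P : Measure Ω} {f g q : Ω → ℝ} {C R : ℝ}

theorem toReal_eLpNorm_two_eq_sqrt (hf : MemLp f 2 P) :
    (eLpNorm f 2 P).toReal = √(∫ ω, |f ω| ^ 2 ∂P) := by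
  rw [hf.eLpNorm_eq_integral_rpow_norm two_ne_zero ENNReal.ofNat_ne_top,
    ENNReal.toReal_ofReal (by positivity), Real.sqrt_eq_rpow]
  simp [one_div]

theorem abs_toReal_eLpNorm_sub_le (hf : MemLp f 2 P) (hg : MemLp g 2 P) :
    |(eLpNorm f 2 P).toReal - (eLpNorm g 2 P).toReal| ≤ (eLpNorm (f - g) 2 P).toReal := by
  have h := abs_norm_sub_norm_le (hf.toLp f) (hg.toLp g)
  rwa [← MemLp.toLp_sub, Lp.norm_toLp, Lp.norm_toLp, Lp.norm_toLp] at h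

theorem integral_le_of_eLpNorm_two_le [IsProbabilityMeasure P] (hR : 0 ≤ R) (hq : MemLp q 2 P)
    (hqR : eLpNorm q 2 P ≤ ENNReal.ofReal R) : ∫ ω, q ω ∂P ≤ R := by
  have h1 : eLpNorm q 1 P ≤ ENNReal.ofReal R :=
    (eLpNorm_le_eLpNorm_of_exponent_le one_le_two hq.1).trans hqR
  have h2 := (hq.mono_exponent one_le_two).eLpNorm_eq_integral_rpow_norm one_ne_zero
    ENNReal.one_ne_top
  simp only [ENNReal.toReal_one, Real.rpow_one, inv_one] at h2
  rw [h2, ENNReal.ofReal_le_ofReal_iff hR] at h1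
  refine (integral_mono_ae (hq.integrable one_le_two) (hq.integrable one_le_two).norm
    (Filter.Eventually.of_forall fun ω => le_abs_self _)).trans h1

theorem memLp_two_of_sq_le (hf : AEMeasurable f P) (hq : Integrable q P)
    (h : ∀ᵐ ω ∂P, f ω ^ 2 ≤ C * q ω) : MemLp f 2 P := by
  rw [memLp_two_iff_integrable_sq hf.aestronglyMeasurable]
  refine (hq.const_mul C).mono' (hf.pow_const 2).aestronglyMeasurable ?_
  filter_upwards [h] with ω hω
  rwa [Real.norm_eq_abs, abs_of_nonneg (sq_nonneg _)]

theorem integral_abs_sq_le (hf : MemLp f 2 P) (hq : Integrable q P)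
    (h : ∀ᵐ ω ∂P, f ω ^ 2 ≤ C * q ω) : ∫ ω, |f ω| ^ 2 ∂P ≤ C * ∫ ω, q ω ∂P := by
  simp only [sq_abs]
  rw [← integral_const_mul]
  exact integral_mono_ae hf.integrable_sq (hq.const_mul C) h

/-- Both second moments lie between `0` and `C * R`, which already bounds their difference. For the
square roots the closeness of `f` and `g` is essential: it is the reverse triangle inequality in L².
-/
theorem mean_square_comparison [IsProbabilityMeasure P] (hC : 0 ≤ C) (hR : 0 ≤ R)
    (hf : AEMeasurable f P) (hg : AEMeasurable g P) (hq : AEMeasurable q P)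
    (hqR : eLpNorm q 2 P ≤ ENNReal.ofReal R)
    (h : ∀ᵐ ω ∂P, f ω ^ 2 ≤ C * q ω ∧ g ω ^ 2 ≤ C * q ω ∧ |f ω - g ω| ≤ C * q ω) :
    MemLp f 2 P ∧ MemLp g 2 P ∧
      |(∫ ω, |f ω| ^ 2 ∂P) - ∫ ω, |g ω| ^ 2 ∂P| ≤ C * R ∧
      |√(∫ ω, |f ω| ^ 2 ∂P) - √(∫ ω, |g ω| ^ 2 ∂P)| ≤ C * R := by
  have hq2 : MemLp q 2 P := ⟨hq.aestronglyMeasurable, hqR.trans_lt ENNReal.ofReal_lt_top⟩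
  have hqi := hq2.integrable one_le_two
  have h1 := h.mono fun ω hω => hω.1
  have h2 := h.mono fun ω hω => hω.2.1
  have hf2 := memLp_two_of_sq_le hf hqi h1
  have hg2 := memLp_two_of_sq_le hg hqi h2
  have hqint := mul_le_mul_of_nonneg_left (integral_le_of_eLpNorm_two_le hR hq2 hqR) hC
  refine ⟨hf2, hg2, ?_, ?_⟩
  · have i1 := integral_abs_sq_le hf2 hqi h1
    have i2 := integral_abs_sq_le hg2 hqi h2
    have j1 : 0 ≤ ∫ ω, |f ω| ^ 2 ∂P := integral_nonneg fun _ => by positivity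
    have j2 : 0 ≤ ∫ ω, |g ω| ^ 2 ∂P := integral_nonneg fun _ => by positivity
    rw [abs_le]
    constructor <;> linarith
  · rw [← toReal_eLpNorm_two_eq_sqrt hf2, ← toReal_eLpNorm_two_eq_sqrt hg2]
    refine (abs_toReal_eLpNorm_sub_le hf2 hg2).trans ?_
    refine ENNReal.toReal_le_of_le_ofReal (by positivity) ?_
    have h3 : eLpNorm (f - g) 2 P ≤ ENNReal.ofReal C * eLpNorm q 2 P := by
      refine eLpNorm_le_mul_eLpNorm_of_ae_le_mul ?_ 2
      filter_upwards [h] with ω hω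
      exact hω.2.2.trans (mul_le_mul_of_nonneg_left (le_abs_self _) hC)
    rw [ENNReal.ofReal_mul hC]
    exact h3.trans (mul_le_mul_right hqR _)

end SquareIntegrable

/-! ### Weighted error versus linearized error, and the conclusion. -/

section Path

variable {a σ b x : ℝ → ℝ} {M K β x₀ : ℝ} {e : ℝ → ℝ}

theorem continuousOn_linearizedError_integrand (h : CoefficientBounds a σ M)
    (hx : ContinuousOn x (Icc 0 1)) (he : ContinuousOn e (Icc 0 1)) :
    ContinuousOn (fun t => σ (x 1) * lampertiSlope a σ (x t) *
      Real.exp (∫ s in t..1, lampertiSlope a σ (x s)) * e t) (Icc 0 1) := by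
  have hγ : ContinuousOn (fun t => lampertiSlope a σ (x t)) (Icc 0 1) :=
    h.slope_continuous.comp_continuousOn hx
  have hI : ContinuousOn (fun t => ∫ s in t..1, lampertiSlope a σ (x s)) (Icc 0 1) := by
    have := intervalIntegral.continuousOn_primitive_interval_left (μ := volume) (a := 0) (b := 1)
      (f := fun t => lampertiSlope a σ (x t))
      (by rw [uIcc_of_le zero_le_one]; exact hγ.integrableOn_Icc)
    rwa [uIcc_of_le zero_le_one] at this
  exact ((continuousOn_const.mul hγ).mul (Real.continuous_exp.comp_continuousOn hI)).mul he

theorem IsLampertiSolution.weightedInterpolationError_eq (hx : IsLampertiSolution a σ b x x₀)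
    (h : CoefficientBounds a σ M) (hb : UnitHolder K β b) (hβ : 1 / 2 < β) (hβ1 : β ≤ 1) (n : ℕ) :
    weightedInterpolationError a σ b x n
      = -linearizedError a σ x (fun t => b t - linearInterpolation n b t) := by
  rw [weightedInterpolationError, linearizedError, ← intervalIntegral.integral_neg]
  refine intervalIntegral.integral_congr fun t ht => ?_
  rw [uIcc_of_le zero_le_one] at ht
  simp only [hx.weightFunction_eq h hb hβ hβ1 ht]
  ring

theorem IsLampertiSolution.intervalIntegrable_weightFunction_mul
    (hx : IsLampertiSolution a σ b x x₀) (h : CoefficientBounds a σ M) (hb : UnitHolder K β b)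
    (hβ : 1 / 2 < β) (hβ1 : β ≤ 1) (he : ContinuousOn e (Icc 0 1)) :
    IntervalIntegrable (fun t => weightFunction a σ b x t * e t) volume 0 1 := by
  refine ContinuousOn.intervalIntegrable ?_
  rw [uIcc_of_le zero_le_one]
  refine (continuousOn_linearizedError_integrand h hx.continuousOn he).neg.congr fun t ht => ?_
  simp only [hx.weightFunction_eq h hb hβ hβ1 ht, Pi.neg_apply]
  ring

theorem aemeasurable_linearizedError {Ω : Type*} [MeasurableSpace Ω] {P : Measure Ω}
    (h : CoefficientBounds a σ M) {X E : ℝ → Ω → ℝ}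
    (hX : ∀ t ∈ Icc (0 : ℝ) 1, AEMeasurable (X t) P)
    (hE : ∀ t ∈ Icc (0 : ℝ) 1, AEMeasurable (E t) P)
    (hXc : ∀ᵐ ω ∂P, ContinuousOn (fun t => X t ω) (Icc 0 1))
    (hEc : ∀ᵐ ω ∂P, ContinuousOn (fun t => E t ω) (Icc 0 1)) :
    AEMeasurable (fun ω => linearizedError a σ (fun t => X t ω) (fun t => E t ω)) P := by
  have hγ : ∀ t ∈ Icc (0 : ℝ) 1, AEMeasurable (fun ω => lampertiSlope a σ (X t ω)) P :=
    fun t ht => h.slope_continuous.measurable.comp_aemeasurable (hX t ht)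
  have hI : ∀ t ∈ Icc (0 : ℝ) 1,
      AEMeasurable (fun ω => ∫ s in t..1, lampertiSlope a σ (X s ω)) P := fun t ht =>
    aemeasurable_integral_of_continuousOn ht.2
      (hXc.mono fun ω hω => (h.slope_continuous.comp_continuousOn hω).mono
        (Icc_subset_Icc_left ht.1))
      (fun s hs => hγ s ⟨ht.1.trans hs.1, hs.2⟩)
  refine aemeasurable_integral_of_continuousOn zero_le_one ?_ fun t ht => ?_
  · filter_upwards [hXc, hEc] with ω h1 h2 using continuousOn_linearizedError_integrand h h1 h2
  · exact (((h.continuous.measurable.comp_aemeasurable (hX 1 (by simp))).mul (hγ t ht)).mul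
      (Real.measurable_exp.comp_aemeasurable (hI t ht))).mul (hE t ht)

end Path

theorem mainTheorem7 (H : ℝ) (hH : 1 / 2 < H) (hH1 : H < 1) (a σ : ℝ → ℝ) (x₀ : ℝ)
    (ha : ContDiff ℝ 2 a) (ha_bdd : ∀ k ≤ 2, ∃ M, ∀ x, |iteratedDeriv k a x| ≤ M)
    (hσ : ContDiff ℝ 3 σ) (hσ_bdd : ∀ k ≤ 3, ∃ M, ∀ x, |iteratedDeriv k σ x| ≤ M)
    (hσ_pos : ∃ c > 0, ∀ x, c ≤ σ x) :
    ∃ C : ℝ, ∀ (Ω : Type*) [MeasurableSpace Ω] (P : Measure Ω) [IsProbabilityMeasure P]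
      (B : ℝ → Ω → ℝ) (X : ℝ → Ω → ℝ) (Xn : ℕ → ℝ → Ω → ℝ),
      IsFractionalBrownianMotion H B P →
      (∀ t ∈ Icc (0 : ℝ) 1, AEMeasurable (X t) P) →
      (∀ n ≥ 1, ∀ t ∈ Icc (0 : ℝ) 1, AEMeasurable (Xn n t) P) →
      (∀ᵐ ω ∂P, IsPathwiseSolution a σ x₀ (fun t => B t ω) (fun t => X t ω)) →
      (∀ n ≥ 1, ∀ᵐ ω ∂P, IsPathwiseSolution a σ x₀
        (linearInterpolation n (fun t => B t ω)) (fun t => Xn n t ω)) →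
      -- the integrals entering the weight and the weighted error exist
      (∀ᵐ ω ∂P, ∀ t ∈ Icc (0 : ℝ) 1, ∃ I,
        HasRSIntegral (fun s => deriv σ (X s ω)) (fun s => B s ω) t 1 I) ∧
      ∀ n ≥ 1,
        (∀ᵐ ω ∂P, IntervalIntegrable (fun t =>
          weightFunction a σ (fun s => B s ω) (fun s => X s ω) t *
            (B t ω - linearInterpolation n (fun s => B s ω) t)) volume 0 1) ∧
        MemLp (fun ω => X 1 ω - Xn n 1 ω) 2 P ∧
        MemLp (fun ω =>
          weightedInterpolationError a σ (fun s => B s ω) (fun s => X s ω) n) 2 P ∧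
        -- the mean-square errors
        |(∫ ω, |X 1 ω - Xn n 1 ω| ^ 2 ∂P) -
          ∫ ω, |weightedInterpolationError a σ (fun s => B s ω) (fun s => X s ω) n| ^ 2 ∂P|
          ≤ C * (n : ℝ) ^ (-(2 * H)) ∧
        -- the root-mean-square errors
        |√(∫ ω, |X 1 ω - Xn n 1 ω| ^ 2 ∂P) -
          √(∫ ω, |weightedInterpolationError a σ (fun s => B s ω) (fun s => X s ω) n| ^ 2 ∂P)|
          ≤ C * (n : ℝ) ^ (-(2 * H)) := by
  obtain ⟨M, h⟩ := exists_coefficientBounds ha ha_bdd (hσ.of_le (by norm_num))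
    (fun k hk => hσ_bdd k (by omega)) hσ_pos
  obtain ⟨C, hC0, hC⟩ := h.exists_error_bound
  set κ := (2 * (eLpNorm id 4 (gaussianReal 0 1)).toReal) ^ 2 with hκ
  -- Both factors are fixed before the probability space: `C` by the coefficients, `κ` by the fourth
  -- moment of a standard Gaussian.
  refine ⟨C * κ, fun Ω _ P _ B X Xn hB hX hXn hsol hsoln => ?_⟩
  have hH0 : 0 < H := by linarith
  -- Paths are Hölder only below `H`, while the chain rule needs an exponent above 1/2. The rate
  -- itself is not affected, since it comes from moments.
  obtain ⟨β, hβ, hβH⟩ := exists_between hH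
  have hβ0 : 0 < β := by linarith
  have hβ1 : β ≤ 1 := by linarith
  have hhol := hB.ae_exists_unitHolder hβ0 hβH
  have hlam : ∀ᵐ ω ∂P, IsLampertiSolution a σ (fun t => B t ω) (fun t => X t ω) x₀ := by
    filter_upwards [hhol, hsol] with ω ⟨K, hK⟩ hω
    exact ⟨hω.1, fun t ht => hω.lamperti_eq h hK hβ ht⟩
  refine ⟨?_, fun n hn => ?_⟩
  · filter_upwards [hhol, hlam] with ω ⟨K, hK⟩ hω t ht
    exact ⟨_, hω.hasRSIntegral h hK hβ hβ1 ht⟩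
  -- The Hölder constant of the interpolated driver may depend on `n` and `ω`: it only justifies the
  -- chain rule and enters no estimate.
  have hlamn : ∀ᵐ ω ∂P, IsLampertiSolution a σ (linearInterpolation n fun t => B t ω)
      (fun t => Xn n t ω) x₀ := by
    filter_upwards [hsoln n hn] with ω hω
    obtain ⟨K, hK⟩ := exists_unitHolder_linearInterpolation n (fun t => B t ω) hβ1
    exact ⟨hω.1, fun t ht => hω.lamperti_eq h hK hβ ht⟩
  have hec : ∀ᵐ ω ∂P, ContinuousOn (fun t => B t ω - linearInterpolation n (fun s => B s ω) t)
      (Icc 0 1) := by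
    filter_upwards [hhol] with ω ⟨K, hK⟩
    obtain ⟨K', hK'⟩ := exists_unitHolder_linearInterpolation n (fun t => B t ω) hβ1
    exact (hK.continuousOn hβ0).sub (hK'.continuousOn hβ0)
  have hem : ∀ t ∈ Icc (0 : ℝ) 1,
      AEMeasurable (fun ω => B t ω - linearInterpolation n (fun s => B s ω) t) P :=
    fun t ht => hB.aemeasurable_interpolation_error hn ht
  have hweight : ∀ᵐ ω ∂P, weightedInterpolationError a σ (fun s => B s ω) (fun s => X s ω) n
      = -linearizedError a σ (fun s => X s ω)
        (fun t => B t ω - linearInterpolation n (fun s => B s ω) t) := by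
    filter_upwards [hhol, hlam] with ω ⟨K, hK⟩ hω
    exact hω.weightedInterpolationError_eq h hK hβ hβ1 n
  have hlin := aemeasurable_linearizedError h hX hem (hlam.mono fun ω hω => hω.continuousOn) hec
  have h1 : (1 : ℝ) ∈ Icc (0 : ℝ) 1 := by simp
  have hn0 : (0 : ℝ) < n := by exact_mod_cast hn
  obtain ⟨k1, k2, k3, k4⟩ := mean_square_comparison hC0
    (by positivity : 0 ≤ κ * (n : ℝ) ^ (-(2 * H))) ((hX 1 h1).sub (hXn n hn 1 h1)) hlin
    (aemeasurable_integral_of_continuousOn (s := 0) (t := 1)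
      (Z := fun t ω => (B t ω - linearInterpolation n (fun s => B s ω) t) ^ 2) zero_le_one
      (hec.mono fun ω hω => hω.pow 2) (fun t ht => (hem t ht).pow_const 2))
    (hB.eLpNorm_integral_sq_interpolation_error_le hH0 hn hec) (by
      filter_upwards [hlam, hlamn, hec] with ω hω hωn hωe
      exact hC _ _ _ _ x₀ hω hωn hωe (by rw [linearInterpolation_zero, sub_self])
        (by rw [linearInterpolation_one hn, sub_self]))
  have hsq : ∫ ω, |weightedInterpolationError a σ (fun s => B s ω) (fun s => X s ω) n| ^ 2 ∂P
      = ∫ ω, |linearizedError a σ (fun s => X s ω)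
        (fun t => B t ω - linearInterpolation n (fun s => B s ω) t)| ^ 2 ∂P := by
    refine integral_congr_ae ?_
    filter_upwards [hweight] with ω hω
    rw [hω, abs_neg]
  refine ⟨?_, k1, (memLp_congr_ae hweight).2 k2.neg, ?_, ?_⟩
  · filter_upwards [hhol, hlam, hec] with ω ⟨K, hK⟩ hω hωe
    exact hω.intervalIntegrable_weightFunction_mul h hK hβ hβ1 hωe
  · rw [hsq, mul_assoc]
    exact k3
  · rw [hsq, mul_assoc]
    exact k4
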